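/- **Theorem (Tractable convex program).** *System and control laws.* Let $N,N_s\ge 1$ and consider $x_0=x$, $x_{t+1}=Ax_t+Bu_t+Cw_t$, $y_t=Dx_t+Ew_t$, with $x_t\in\mathbb R^{n_x}$, $u_t\in\mathbb R^{n_u}$, $y_t\in\mathbb R^{n_y}$, $w_t\in\mathbb R^{n_w}$ (time is counted from the current sampling instant). The model is $\hat x_0=0$, $\hat x_{t+1}=A\hat x_t+Bu_t$, $\hat y_t=D\hat x_t$, and $v_t=y_t-\hat y_t$ is the purified output. A purified-output-based (POB) affine control law $H_N$ is a family $h_t\in\mathbb R^{n_u}$, $H_{t,\tau}\in\mathbb R^{n_u\times n_y}$ $(0\le\tau\le t<N)$ with $u_t=h_t+\sum_{\tau\le t}H_{t,\tau}v_\tau$; it is identified with the matrix $H_N=[\,h\;|\;(H_{t,\tau})\,]$, where $H_{t,\tau}=0$ for $\tau>t$. Write $\xi=(w_0,\dots,w_{N-1})\in\mathbb R^{Nn_w}$. *Ambiguity set.* Fix a norm $\|\cdot\|$ on $\mathbb R^{Nn_w}$ with dual norm $\|z\|_*=\sup_{\|\xi\|\le1}\langle z,\xi\rangle$. Let $\Xi=\{\xi: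 C_\xi\xi\le d_\xi\}$ be a polyhedron (in particular, any polytope), and let $\mathcal M(\Xi)$ be the set of probability distributions $\mathbb Q$ supported on $\Xi$ with $\int\|\xi\|\,d\mathbb Q<\infty$ and $\int\exp(\|\xi\|^\alpha)\,d\mathbb Q<\infty$ for some $\alpha>0$ (the two moment conditions are automatic if $\Xi$ is bounded). Given samples $\hat\xi_1,\dots,\hat\xi_{N_s}\in\Xi$ and $\varepsilon>0$, let $\widehat{\mathbb P}_{N_s}=\frac1{N_s}\sum_i\delta_{\hat\xi_i}$ and let $\mathbb B_\varepsilon$ be the set of all $\mathbb Q\in\mathcal M(\Xi)$ whose type-1 Wasserstein distance to $\widehat{\mathbb P}_{N_s}$ is at most $\varepsilon$. Let $\mathbb B_\varepsilon^{\rm iid}\subseteq\mathbb B_\varepsilon$ be the set of those $\mathbb Q$ under which $w_0,\dots,w_{N-1}$ are i.i.d. with the known mean $\mu$ and covariance matrix $\Sigma$ (finite second moments). Assume $\mathbb B_\varepsilon^{\rm iid}\neq\emptyset$, as is the case when the ball contains the true distribution. *The distributionally robust problem (10).* Let $\beta\in(0,1]$, $Q,Q_f\succeq0$, $R\succ0$,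 $g_1,\dots,g_{N_b}\in\mathbb R^{n_x}$ (for example $g_j=e_m$, bounding the $m$-th state component, or $g_j=-e_m$) and $U_j\in\mathbb R$. Minimize over POB laws $H_N$ $$J_N(x,H_N)=\inf_{\mathbb Q\in\mathbb B^{\rm iid}_\varepsilon}\mathbb E_{\mathbb Q}\Big[\sum_{t=0}^{N-1}\beta^t\big(x_t^\top Qx_t+u_t^\top Ru_t\big)+\beta^Nx_N^\top Q_fx_N\Big]$$ subject to $\sup_{\mathbb Q\in\mathbb B_\varepsilon}\mathbb E_{\mathbb Q}[\ell_j(\xi,H_N)]\le U_j$ for all $j\le N_b$, where $\ell_j(\xi,H_N)=\max_{1\le t\le N}\langle g_j,x_t\rangle$ along the closed-loop trajectory. *The cone program (11).* Let $A_x,B_x,C_x$ be the matrices with $x_{[0:N]}=A_xx+B_xu_{[0:N-1]}+C_x\xi$ for the open-loop system: their $t$-th block rows have the blocks $A^t$; $A^{t-1-\tau}B$ for $\tau<t$; $A^{t-1-\tau}C$ for $\tau<t$; all other blocks are $0$. Let $A_y,C_y$ have the blocks $DA^t$ and $DA^{t-1-\tau}C$ ($\tau<t$, else $0$), and $E_y=I_N\otimes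 E$. Put $$\tilde C_x=[A_xx,\;C_x],\quad \tilde C_y=\begin{bmatrix}0&0\\A_yx&C_y\end{bmatrix},\quad \tilde E_y=\begin{bmatrix}1&0\\0&E_y\end{bmatrix},\quad \tilde H_N=H_N(\tilde C_y+\tilde E_y),\quad K=\tilde C_x+B_x\tilde H_N,$$ $J_x=\operatorname{diag}(\operatorname{diag}(\beta^0,\dots,\beta^{N-1})\otimes Q,\ \beta^NQ_f)$, $J_u=\operatorname{diag}(\beta^0,\dots,\beta^{N-1})\otimes R$, $\mu_w=(1,\mu,\dots,\mu)$ and $\Sigma_w=\operatorname{diag}(0,I_N\otimes\Sigma)$ (mean and covariance of $(1,\xi)$). For $1\le t\le N$ let $K_t$ be the $t$-th block of $n_x$ rows of $K$, let $b_{tj}$ be the first entry of $g_j^\top K_t$ and $a_{tj}\in\mathbb R^{Nn_w}$ the vector of its remaining entries. The program is $$\begin{aligned}\inf_{H_N,\lambda,s,\gamma}\ &\operatorname{Tr}\{M\Sigma_w\}+\mu_w^\top M\mu_w,\qquad M=K^\top J_xK+\tilde H_N^\top J_u\tilde H_N,\\ \text{s.t. }&\lambda_j\varepsilon+\tfrac1{N_s}\textstyle\sum_{i=1}^{N_s}s_{ij}\le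 U_j,\\ &b_{tj}+\langle a_{tj},\hat\xi_i\rangle+\langle\gamma_{ijt},d_\xi-C_\xi\hat\xi_i\rangle\le s_{ij},\\ &\|C_\xi^\top\gamma_{ijt}-a_{tj}\|_*\le\lambda_j,\quad\gamma_{ijt}\ge0\qquad\forall i\le N_s,\ j\le N_b,\ 1\le t\le N,\end{aligned}$$ over POB laws $H_N$ and $\lambda_j,s_{ij}\in\mathbb R$, $\gamma_{ijt}$ real vectors. *Conclusion.* Problem (10) is equivalent to the finite-dimensional convex program (11): 1. $H_N$ is feasible for (10) if and only if $(H_N,\lambda,s,\gamma)$ is feasible for (11) for some $\lambda,s,\gamma$; 2. for every POB law $H_N$, $J_N(x,H_N)$ equals the objective of (11) at $H_N$; 3. the optimal values of (10) and (11) in $[-\infty,\infty]$ coincide; 4. $H_N$ is optimal for (10) if and only if $(H_N,\lambda,s,\gamma)$ is optimal for (11) for some $\lambda,s,\gamma$; 5. the feasible set of (11) is convex and its objective is convex on it. Claims 2–4 also hold when the infimum over $\mathbb B^{\rm iid}_\varepsilon$ in $J_N$ is replaced by the supremum (worst case). -/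

import Mathlib

open MeasureTheory ProbabilityTheory Matrix
open scoped ENNReal Kronecker

namespace DRMPC

/-! ### Distributions on a polyhedral set, the type-1 Wasserstein ball -/

/-- The polyhedral uncertainty set `{ξ | C ξ ≤ d}`. -/
def uncertaintySet {ι ρ : Type*} [Fintype ι] (Cξ : Matrix ρ ι ℝ) (dξ : ρ → ℝ) : Set (ι → ℝ) :=
  {ξ | ∀ k, (Cξ *ᵥ ξ) k ≤ dξ k}

/-- The norm dual to `p`: `‖z‖_* = sup {⟨z, ξ⟩ | p ξ ≤ 1}`. -/
noncomputable def dualNorm {ι : Type*} [Fintype ι] (p : Seminorm ℝ (ι → ℝ)) (z : ι → ℝ) : ℝ :=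
  sSup {r : ℝ | ∃ ξ : ι → ℝ, p ξ ≤ 1 ∧ r = z ⬝ᵥ ξ}

/-- `ℳ(Ξ)`: the probability distributions supported on `Ξ` with finite first moment and
a finite exponential moment `∫ exp (‖ξ‖ ^ α)` for some `α > 0`; the norm is `p`. -/
def distributionsOn {ι : Type*} [Fintype ι] (p : Seminorm ℝ (ι → ℝ)) (Ξ : Set (ι → ℝ)) :
    Set (Measure (ι → ℝ)) :=
  {Q | IsProbabilityMeasure Q ∧ (∀ᵐ ξ ∂Q, ξ ∈ Ξ) ∧
    (∫⁻ ξ, ENNReal.ofReal (p ξ) ∂Q) < ∞ ∧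
    ∃ α : ℝ, 0 < α ∧ (∫⁻ ξ, ENNReal.ofReal (Real.exp (p ξ ^ α)) ∂Q) < ∞}

/-- The type-1 Wasserstein distance with respect to the norm `p`: the infimum of the transport cost
over all joint distributions with the given marginals. -/
noncomputable def wasserstein {ι : Type*} [Fintype ι] (p : Seminorm ℝ (ι → ℝ))
    (Q₁ Q₂ : Measure (ι → ℝ)) : ℝ≥0∞ :=
  ⨅ π ∈ {π : Measure ((ι → ℝ) × (ι → ℝ)) | π.map Prod.fst = Q₁ ∧ π.map Prod.snd = Q₂},
    ∫⁻ z, ENNReal.ofReal (p (z.1 - z.2)) ∂π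

/-- The empirical distribution `(1 / Ns) ∑ i, δ_{ξ̂ i}` of the samples. -/
noncomputable def empirical {ι : Type*} {Ns : ℕ} (ξhat : Fin Ns → ι → ℝ) :
    Measure (ι → ℝ) :=
  (Ns : ℝ≥0∞)⁻¹ • ∑ i, Measure.dirac (ξhat i)

/-- The Wasserstein ball of radius `ε` in `ℳ(Ξ)` around the empirical distribution. -/
def wassersteinBall {ι : Type*} [Fintype ι] {Ns : ℕ} (p : Seminorm ℝ (ι → ℝ)) (Ξ : Set (ι → ℝ))
    (ξhat : Fin Ns → ι → ℝ) (ε : ℝ) : Set (Measure (ι → ℝ)) :=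
  {Q | Q ∈ distributionsOn p Ξ ∧ wasserstein p (empirical ξhat) Q ≤ ENNReal.ofReal ε}

/-- Under `Q` the disturbances `w_t = ξ (t, ·)`, `t < N`, are independent and identically
distributed, with mean vector `μw` and covariance matrix `Sw`. -/
structure IsIIDWithMoments {N nw : ℕ} (Q : Measure (Fin N × Fin nw → ℝ))
    (μw : Fin nw → ℝ) (Sw : Matrix (Fin nw) (Fin nw) ℝ) : Prop where
  indep : iIndepFun (fun (t : Fin N) (ξ : Fin N × Fin nw → ℝ) (i : Fin nw) => ξ (t, i)) Q
  ident : ∀ t t' : Fin N,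
    IdentDistrib (fun (ξ : Fin N × Fin nw → ℝ) (i : Fin nw) => ξ (t, i))
      (fun (ξ : Fin N × Fin nw → ℝ) (i : Fin nw) => ξ (t', i)) Q Q
  memLp : ∀ (t : Fin N) (i : Fin nw), MemLp (fun ξ : Fin N × Fin nw → ℝ => ξ (t, i)) 2 Q
  mean : ∀ (t : Fin N) (i : Fin nw), ∫ ξ, ξ (t, i) ∂Q = μw i
  cov : ∀ (t : Fin N) (i i' : Fin nw),
    covariance (fun ξ : Fin N × Fin nw → ℝ => ξ (t, i)) (fun ξ => ξ (t, i')) Q = Sw i i'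

/-! ### The disturbed system, its model, and purified-output-based affine control laws -/

/-- `x_{t+1} = A x_t + B u_t + C w_t`, `y_t = D x_t + E w_t`. -/
structure LTISystem (nx nu ny nw : ℕ) where
  A : Matrix (Fin nx) (Fin nx) ℝ
  B : Matrix (Fin nx) (Fin nu) ℝ
  C : Matrix (Fin nx) (Fin nw) ℝ
  D : Matrix (Fin ny) (Fin nx) ℝ
  E : Matrix (Fin ny) (Fin nw) ℝ

/-- The stacked law `H_N = [h | H]`: the column `Sum.inl ()` holds the `h_t`, and the block at
`(t, ·), Sum.inr (τ, ·)` is `H_{t,τ}`. -/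
abbrev LawMatrix (N nu ny : ℕ) : Type := Matrix (Fin N × Fin nu) (Unit ⊕ Fin N × Fin ny) ℝ

/-- Only the blocks `H_{t,τ}` with `τ ≤ t` occur in a control law. -/
def IsCausal {N nu ny : ℕ} (H : LawMatrix N nu ny) : Prop :=
  ∀ (t τ : Fin N) (i : Fin nu) (j : Fin ny), t < τ → H (t, i) (Sum.inr (τ, j)) = 0

/-- The disturbance `w_t` in the stacked sequence `ξ`; only times `t < N` matter. -/
def disturbance {N nw : ℕ} (ξ : Fin N × Fin nw → ℝ) (t : ℕ) : Fin nw → ℝ :=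
  fun i => if h : t < N then ξ (⟨t, h⟩, i) else 0

section ClosedLoop

variable {nx nu ny nw N : ℕ} (S : LTISystem nx nu ny nw) (x₀ : Fin nx → ℝ)
  (H : LawMatrix N nu ny) (ξ : Fin N × Fin nw → ℝ)

/-- The discrepancy `δ_t` between the disturbed system and its model. -/
def discrepancy : ℕ → Fin nx → ℝ
  | 0 => x₀
  | t + 1 => S.A *ᵥ discrepancy t + S.C *ᵥ disturbance ξ t

/-- The purified output `v_t = D δ_t + E w_t`; see `purified_eq` for `v_t = y_t - ŷ_t`. -/
def purified (t : ℕ) : Fin ny → ℝ :=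
  S.D *ᵥ discrepancy S x₀ ξ t + S.E *ᵥ disturbance ξ t

/-- The input `u_t = h_t + ∑_{τ ≤ t} H_{t,τ} v_τ` for `t < N` (and `0` beyond the horizon). -/
def input (t : ℕ) : Fin nu → ℝ :=
  fun i => if h : t < N then
      H (⟨t, h⟩, i) (Sum.inl ()) +
        ∑ τ : Fin N with τ.val ≤ t, ∑ j : Fin ny,
          H (⟨t, h⟩, i) (Sum.inr (τ, j)) * purified S x₀ ξ τ.val j
    else 0

/-- The closed-loop state `x_t`. -/
def state : ℕ → Fin nx → ℝ
  | 0 => x₀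
  | t + 1 => S.A *ᵥ state t + S.B *ᵥ input S x₀ H ξ t + S.C *ᵥ disturbance ξ t

/-- The output `y_t`. -/
def output (t : ℕ) : Fin ny → ℝ :=
  S.D *ᵥ state S x₀ H ξ t + S.E *ᵥ disturbance ξ t

/-- The state of the model, started at the equilibrium and driven by the same inputs. -/
def modelState : ℕ → Fin nx → ℝ
  | 0 => 0
  | t + 1 => S.A *ᵥ modelState t + S.B *ᵥ input S x₀ H ξ t

/-- The output of the model. -/
def modelOutput (t : ℕ) : Fin ny → ℝ :=
  S.D *ᵥ modelState S x₀ H ξ t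

theorem discrepancy_eq (t : ℕ) :
    discrepancy S x₀ ξ t = state S x₀ H ξ t - modelState S x₀ H ξ t := by
  induction t with
  | zero => simp [discrepancy, state, modelState]
  | succ t ih =>
    simp only [discrepancy, state, modelState, ih, Matrix.mulVec_sub]
    abel

/-- The purified output is the difference of the outputs of the disturbed system and the model. -/
theorem purified_eq (t : ℕ) :
    purified S x₀ ξ t = output S x₀ H ξ t - modelOutput S x₀ H ξ t := by
  simp only [purified, output, modelOutput, discrepancy_eq S x₀ H ξ t, Matrix.mulVec_sub]
  abel

/-- The discounted quadratic cost of the closed-loop trajectory. -/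
def cost (β : ℝ) (Q Qf : Matrix (Fin nx) (Fin nx) ℝ) (R : Matrix (Fin nu) (Fin nu) ℝ) : ℝ :=
  (∑ t ∈ Finset.range N, β ^ t *
      (state S x₀ H ξ t ⬝ᵥ Q *ᵥ state S x₀ H ξ t + input S x₀ H ξ t ⬝ᵥ R *ᵥ input S x₀ H ξ t)) +
    β ^ N * (state S x₀ H ξ N ⬝ᵥ Qf *ᵥ state S x₀ H ξ N)

/-- The constraint function `max_{1 ≤ t ≤ N} ⟨g, x_t⟩`; `g = e_m` selects the `m`-th component of
the state, `g = -e_m` gives a lower bound on it. -/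
noncomputable def loss (g : Fin nx → ℝ) : ℝ :=
  ⨆ t : Fin N, g ⬝ᵥ state S x₀ H ξ (t.val + 1)

end ClosedLoop

/-! ### The distributionally robust control problem -/

/-- All data of the control problem with horizon `N`, `Ns` samples, `Nb` constraints on the state
at each sampling time, and an uncertainty set cut out by `r` inequalities. -/
structure Problem (nx nu ny nw N Ns Nb r : ℕ) where
  /-- the controlled system -/
  sys : LTISystem nx nu ny nw
  /-- the initial state -/
  x₀ : Fin nx → ℝ
  /-- the discount factor -/
  β : ℝ
  /-- the weight of the states -/
  Q : Matrix (Fin nx) (Fin nx) ℝ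
  /-- the weight of the final state -/
  Qf : Matrix (Fin nx) (Fin nx) ℝ
  /-- the weight of the inputs -/
  R : Matrix (Fin nu) (Fin nu) ℝ
  /-- the constraint directions -/
  g : Fin Nb → Fin nx → ℝ
  /-- the constraint bounds -/
  U : Fin Nb → ℝ
  /-- the norm on the space of disturbance sequences -/
  p : Seminorm ℝ (Fin N × Fin nw → ℝ)
  /-- the matrix of the uncertainty set -/
  Cξ : Matrix (Fin r) (Fin N × Fin nw) ℝ
  /-- the right-hand side of the uncertainty set -/
  dξ : Fin r → ℝ
  /-- the sampled disturbance sequences -/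
  ξhat : Fin Ns → Fin N × Fin nw → ℝ
  /-- the radius of the Wasserstein ball -/
  ε : ℝ
  /-- the mean of a single disturbance -/
  μw : Fin nw → ℝ
  /-- the covariance matrix of a single disturbance -/
  Sw : Matrix (Fin nw) (Fin nw) ℝ

namespace Problem

variable {nx nu ny nw N Ns Nb r : ℕ} (P : Problem nx nu ny nw N Ns Nb r)

/-- The polyhedral support `Ξ`. -/
def support : Set (Fin N × Fin nw → ℝ) := uncertaintySet P.Cξ P.dξ

/-- The ambiguity set: the Wasserstein ball around the empirical distribution. -/
def ball : Set (Measure (Fin N × Fin nw → ℝ)) := wassersteinBall P.p P.support P.ξhat P.ε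

/-- The distributions in the ambiguity set for which the disturbances are i.i.d. with the known
mean and covariance matrix. -/
def iidBall : Set (Measure (Fin N × Fin nw → ℝ)) := {ν ∈ P.ball | IsIIDWithMoments ν P.μw P.Sw}

/-- The expected cost of the control law under the distribution `ν`. -/
noncomputable def expectedCost (H : LawMatrix N nu ny) (ν : Measure (Fin N × Fin nw → ℝ)) : ℝ :=
  ∫ ξ, cost P.sys P.x₀ H ξ P.β P.Q P.Qf P.R ∂ν

/-- The objective with the infimum over the distributions. -/
noncomputable def objectiveInf (H : LawMatrix N nu ny) : EReal :=
  ⨅ ν ∈ P.iidBall, (P.expectedCost H ν : EReal)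

/-- The objective with the supremum over the distributions (the worst case). -/
noncomputable def objectiveSup (H : LawMatrix N nu ny) : EReal :=
  ⨆ ν ∈ P.iidBall, (P.expectedCost H ν : EReal)

/-- The control laws that satisfy the distributionally robust constraints
`sup_{ν ∈ ball} 𝔼_ν[ℓ_j(ξ, H)] ≤ U_j` over the whole Wasserstein ball. -/
def feasible : Set (LawMatrix N nu ny) :=
  {H | IsCausal H ∧ ∀ j,
    (⨆ ν ∈ P.ball, ((∫ ξ, loss P.sys P.x₀ H ξ (P.g j) ∂ν : ℝ) : EReal)) ≤ (P.U j : EReal)}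

/-! ### The stacked matrices and the cone program -/

/-- `A_x`, with blocks `A ^ t`, `t ≤ N`. -/
def Ax : Matrix (Fin (N + 1) × Fin nx) (Fin nx) ℝ :=
  Matrix.of fun a j => (P.sys.A ^ a.1.val) a.2 j

/-- `B_x`, with blocks `A ^ (t - 1 - τ) B` for `τ < t`. -/
def Bx : Matrix (Fin (N + 1) × Fin nx) (Fin N × Fin nu) ℝ :=
  Matrix.of fun a b =>
    if b.1.val < a.1.val then (P.sys.A ^ (a.1.val - 1 - b.1.val) * P.sys.B) a.2 b.2 else 0

/-- `C_x`, with blocks `A ^ (t - 1 - τ) C` for `τ < t`. -/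
def Cx : Matrix (Fin (N + 1) × Fin nx) (Fin N × Fin nw) ℝ :=
  Matrix.of fun a b =>
    if b.1.val < a.1.val then (P.sys.A ^ (a.1.val - 1 - b.1.val) * P.sys.C) a.2 b.2 else 0

/-- `A_y`, with blocks `D A ^ t`, `t < N`. -/
def Ay : Matrix (Fin N × Fin ny) (Fin nx) ℝ :=
  Matrix.of fun a j => (P.sys.D * P.sys.A ^ a.1.val) a.2 j

/-- `C_y`, with blocks `D A ^ (t - 1 - τ) C` for `τ < t`. -/
def Cy : Matrix (Fin N × Fin ny) (Fin N × Fin nw) ℝ :=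
  Matrix.of fun a b =>
    if b.1.val < a.1.val then
      (P.sys.D * P.sys.A ^ (a.1.val - 1 - b.1.val) * P.sys.C) a.2 b.2 else 0

/-- `E_y`, block diagonal with blocks `E`. -/
def Ey : Matrix (Fin N × Fin ny) (Fin N × Fin nw) ℝ :=
  (1 : Matrix (Fin N) (Fin N) ℝ) ⊗ₖ P.sys.E

/-- `C̃_x = [A_x x₀, C_x]`. -/
def Cxt : Matrix (Fin (N + 1) × Fin nx) (Unit ⊕ Fin N × Fin nw) ℝ :=
  Matrix.fromCols (Matrix.replicateCol Unit (P.Ax *ᵥ P.x₀)) P.Cx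

/-- `C̃_y = [0, 0; A_y x₀, C_y]`. -/
def Cyt : Matrix (Unit ⊕ Fin N × Fin ny) (Unit ⊕ Fin N × Fin nw) ℝ :=
  Matrix.fromBlocks 0 0 (Matrix.replicateCol Unit (P.Ay *ᵥ P.x₀)) P.Cy

/-- `Ẽ_y = [1, 0; 0, E_y]`. -/
def Eyt : Matrix (Unit ⊕ Fin N × Fin ny) (Unit ⊕ Fin N × Fin nw) ℝ :=
  Matrix.fromBlocks 1 0 0 P.Ey

/-- `H̃_N = H_N (C̃_y + Ẽ_y)`: the stacked input is `H̃_N [1; ξ]`. -/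
def Ht (H : LawMatrix N nu ny) : Matrix (Fin N × Fin nu) (Unit ⊕ Fin N × Fin nw) ℝ :=
  H * (P.Cyt + P.Eyt)

/-- `C̃_x + B_x H̃_N`: the stacked state is `(C̃_x + B_x H̃_N) [1; ξ]`. -/
def K (H : LawMatrix N nu ny) : Matrix (Fin (N + 1) × Fin nx) (Unit ⊕ Fin N × Fin nw) ℝ :=
  P.Cxt + P.Bx * P.Ht H

/-- `J_x = diag(diag(β^0, …, β^(N-1)) ⊗ Q, β^N Q_f)`. -/
def Jx : Matrix (Fin (N + 1) × Fin nx) (Fin (N + 1) × Fin nx) ℝ :=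
  Matrix.of fun a b =>
    if a.1 = b.1 then P.β ^ a.1.val * (if a.1.val < N then P.Q a.2 b.2 else P.Qf a.2 b.2) else 0

/-- `J_u = diag(β^0, …, β^(N-1)) ⊗ R`. -/
def Ju : Matrix (Fin N × Fin nu) (Fin N × Fin nu) ℝ :=
  Matrix.diagonal (fun t : Fin N => P.β ^ t.val) ⊗ₖ P.R

/-- The mean of the extended disturbance sequence `[1; ξ]`. -/
def meanExt : Unit ⊕ Fin N × Fin nw → ℝ := Sum.elim (fun _ => 1) (fun a => P.μw a.2)

/-- The covariance matrix of the extended disturbance sequence `[1; ξ]`. -/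
def covExt : Matrix (Unit ⊕ Fin N × Fin nw) (Unit ⊕ Fin N × Fin nw) ℝ :=
  Matrix.fromBlocks 0 0 0 ((1 : Matrix (Fin N) (Fin N) ℝ) ⊗ₖ P.Sw)

/-- `(C̃_x + B_x H̃_N)ᵀ J_x (C̃_x + B_x H̃_N) + H̃_Nᵀ J_u H̃_N`. -/
def costMatrix (H : LawMatrix N nu ny) :
    Matrix (Unit ⊕ Fin N × Fin nw) (Unit ⊕ Fin N × Fin nw) ℝ :=
  (P.K H)ᵀ * P.Jx * P.K H + (P.Ht H)ᵀ * P.Ju * P.Ht H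

/-- The objective of the cone program. -/
def coneObjective (H : LawMatrix N nu ny) : ℝ :=
  (P.costMatrix H * P.covExt).trace + P.meanExt ⬝ᵥ P.costMatrix H *ᵥ P.meanExt

/-- The vector `a_{tj}`: the disturbance part of `⟨g_j, x_{t+1}⟩`, where `t = 0, …, N - 1`. -/
def aVec (H : LawMatrix N nu ny) (t : Fin N) (j : Fin Nb) : Fin N × Fin nw → ℝ :=
  fun q => ∑ m, P.g j m * P.K H (t.succ, m) (Sum.inr q)

/-- The number `b_{tj}`: the constant part of `⟨g_j, x_{t+1}⟩`, where `t = 0, …, N - 1`. -/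
def bVal (H : LawMatrix N nu ny) (t : Fin N) (j : Fin Nb) : ℝ :=
  ∑ m, P.g j m * P.K H (t.succ, m) (Sum.inl ())

end Problem

/-- The auxiliary variables `λ_j`, `s_{ij}`, `γ_{ijt}` of the cone program. -/
abbrev AuxVar (N Ns Nb r : ℕ) : Type :=
  (Fin Nb → ℝ) × (Fin Ns → Fin Nb → ℝ) × (Fin Ns → Fin Nb → Fin N → Fin r → ℝ)

namespace Problem

variable {nx nu ny nw N Ns Nb r : ℕ} (P : Problem nx nu ny nw N Ns Nb r)

/-- The feasible set of the cone program in the variables `(H_N, λ, s, γ)`. -/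
def coneFeasible : Set (LawMatrix N nu ny × AuxVar N Ns Nb r) :=
  {z | match z with
    | (H, lam, s, γ) =>
      IsCausal H ∧
      (∀ j, lam j * P.ε + (1 / (Ns : ℝ)) * ∑ i, s i j ≤ P.U j) ∧
      (∀ i j t, P.bVal H t j + P.aVec H t j ⬝ᵥ P.ξhat i
          + γ i j t ⬝ᵥ (P.dξ - P.Cξ *ᵥ P.ξhat i) ≤ s i j) ∧
      (∀ i j t, dualNorm P.p (P.Cξᵀ *ᵥ γ i j t - P.aVec H t j) ≤ lam j) ∧
      (∀ i j t k, 0 ≤ γ i j t k)}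

end Problem

end DRMPC

/-!
The proof has three independent parts.

*The cost.* By unrolling the linear recursions, the stacked inputs and states of a causal law `H` are
`H̃ [1; ξ]` and `K [1; ξ]` (`input_eq_mulVec`, `state_eq_mulVec`). The cost is therefore a quadratic
form in `[1; ξ]`, and its expectation depends on the distribution only through the mean and the
covariance matrix of `[1; ξ]`, which all distributions in `iidBall` share. So the infimum and the
supremum range over a single value, the objective of the cone program (`expectedCost_eq`). This value
is convex in `H` because it is an expectation of convex quadratics of affine functions of `H`.

*The dual gives a bound.* If `(H, λ, s, γ)` is feasible for the cone program, then
`ℓ_j(ξ) ≤ s_{ij} + λ_j ‖ξ - ξ̂_i‖` on the support (`loss_le_of_coneFeasible`); integrating this against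
nearly optimal couplings bounds the expectation of `ℓ_j` over the whole Wasserstein ball
(`integral_le_of_mem_wassersteinBall`).

*The bound gives a dual.* Two dualities are combined.
The multiplier `λ` of the transport budget comes from a one-dimensional separation: a choice of one
target point per sample has a transport cost `c` and an average loss `v`, and the hypothesis on the
ball, applied to mixtures of two such choices with total cost `ε`, says that every slope from
`(ε, U)` to a point with `c > ε` is at most every slope from a point with `c < ε` to `(ε, U)`. Any
nonnegative number in between is a multiplier, and the choice that leaves the samples in place
shows that there is one (`exists_wasserstein_multiplier`). Only distributions with finite support
occur here, so the moment conditions in the ambiguity set are harmless.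
The multipliers `γ` of the polyhedral support come from separating the epigraph of `λ ‖·‖` from the
hypograph of an affine function over the polyhedron, which replaces the norm by a linear functional
(`exists_minorant`), followed by the affine Farkas lemma (`affine_farkas`). As the constraints are
linear, no interior point of the polyhedron is needed.
-/

namespace DRMPC

/-! ### Farkas' lemma -/

/-- **Farkas' lemma** for finitely many linear functionals on a real vector space, by induction on
their number; no topology and no finite dimension is needed. -/
theorem farkas_finset {V κ : Type*} [AddCommGroup V] [Module ℝ V] [DecidableEq κ] (s : Finset κ) :
    ∀ (a : κ → V →ₗ[ℝ] ℝ) (b : V →ₗ[ℝ] ℝ),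
      (∀ x, (∀ i ∈ s, a i x ≤ 0) → b x ≤ 0) →
      ∃ γ : κ → ℝ, (∀ i, 0 ≤ γ i) ∧ b = ∑ i ∈ s, γ i • a i := by
  induction s using Finset.induction_on with
  | empty =>
    intro a b h
    refine ⟨0, by simp, ?_⟩
    ext x
    have h1 := h x (by simp)
    have h2 := h (-x) (by simp)
    simp only [map_neg] at h2
    simp only [Finset.sum_empty, LinearMap.zero_apply]
    linarith
  | insert m s hm ih =>
    intro a b h
    by_cases hs : ∀ x, (∀ i ∈ s, a i x ≤ 0) → b x ≤ 0
    · obtain ⟨γ, hγ, hb⟩ := ih a b hs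
      refine ⟨Function.update γ m 0, fun i => ?_, ?_⟩
      · by_cases hi : i = m
        · subst hi; simp
        · simpa [hi] using hγ i
      · rw [Finset.sum_insert hm, hb]
        simp only [Function.update_self, zero_smul, zero_add]
        refine Finset.sum_congr rfl fun i hi => ?_
        rw [Function.update_of_ne (ne_of_mem_of_not_mem hi hm)]
    · push Not at hs
      obtain ⟨x₀, hx₀, hbx₀⟩ := hs
      have hmx₀ : 0 < a m x₀ := by
        by_contra hle
        push Not at hle
        refine absurd (h x₀ fun i hi => ?_) (not_le.mpr hbx₀)
        rcases Finset.mem_insert.1 hi with rfl | hi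
        exacts [hle, hx₀ i hi]
      -- rescale so that `a m` takes the value `1`
      set x₁ : V := (a m x₀)⁻¹ • x₀ with hx₁
      have h1 : a m x₁ = 1 := by simp [hx₁, hmx₀.ne']
      have hax₁ : ∀ i ∈ s, a i x₁ ≤ 0 := fun i hi => by
        rw [hx₁, map_smul, smul_eq_mul]
        exact mul_nonpos_of_nonneg_of_nonpos (inv_nonneg.2 hmx₀.le) (hx₀ i hi)
      have hbx₁ : 0 ≤ b x₁ := by
        rw [hx₁, map_smul, smul_eq_mul]
        positivity
      -- compose all functionals with the projection `x ↦ x - a m x • x₁` onto the kernel of `a m`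
      obtain ⟨γ, hγ, hb⟩ := ih (fun i => a i - a i x₁ • a m) (b - b x₁ • a m) (fun x hx => by
        have := h (x - a m x • x₁) (fun i hi => by
          rcases Finset.mem_insert.1 hi with rfl | hi
          · simp [h1]
          · have := hx i hi
            simp only [LinearMap.sub_apply, LinearMap.smul_apply, smul_eq_mul, map_sub,
              map_smul] at this ⊢
            linarith)
        simp only [LinearMap.sub_apply, LinearMap.smul_apply, smul_eq_mul, map_sub,
              map_smul] at this ⊢
        linarith)
      have hc : 0 ≤ b x₁ - ∑ i ∈ s, γ i * a i x₁ := by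
        have : ∑ i ∈ s, γ i * a i x₁ ≤ 0 := Finset.sum_nonpos fun i hi =>
          mul_nonpos_of_nonneg_of_nonpos (hγ i) (hax₁ i hi)
        linarith
      refine ⟨Function.update γ m (b x₁ - ∑ i ∈ s, γ i * a i x₁), fun i => ?_, ?_⟩
      · by_cases hi : i = m
        · subst hi; simpa using hc
        · simpa [hi] using hγ i
      · rw [Finset.sum_insert hm, Function.update_self]
        have hsum : ∑ i ∈ s, Function.update γ m (b x₁ - ∑ i ∈ s, γ i * a i x₁) i • a i
            = ∑ i ∈ s, γ i • a i := Finset.sum_congr rfl fun i hi => by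
          rw [Function.update_of_ne (ne_of_mem_of_not_mem hi hm)]
        rw [hsum]
        ext x
        have hbx := LinearMap.congr_fun hb x
        simp only [LinearMap.sub_apply, LinearMap.smul_apply, smul_eq_mul, LinearMap.sum_apply,
          LinearMap.add_apply, mul_sub, Finset.sum_sub_distrib] at hbx ⊢
        have : ∑ i ∈ s, γ i * (a i x₁ * a m x) = (∑ i ∈ s, γ i * a i x₁) * a m x := by
          rw [Finset.sum_mul]
          exact Finset.sum_congr rfl fun i _ => by ring
        rw [this] at hbx
        linarith

/-- The affine **Farkas lemma**: a linear inequality that holds on the polyhedron `C η ≤ e` is a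
nonnegative combination of the defining ones. The polyhedron contains `0`, so it is not empty. -/
theorem affine_farkas {ι ρ : Type*} [Fintype ι] [Fintype ρ] (C : Matrix ρ ι ℝ) {e : ρ → ℝ}
    (he : ∀ k, 0 ≤ e k) (a : ι → ℝ) (κ : ℝ)
    (h : ∀ η : ι → ℝ, (∀ k, (C *ᵥ η) k ≤ e k) → a ⬝ᵥ η ≤ κ) :
    ∃ γ : ρ → ℝ, (∀ k, 0 ≤ γ k) ∧ Cᵀ *ᵥ γ = a ∧ γ ⬝ᵥ e ≤ κ := by
  classical
  -- homogenize: `(η, τ)` with `0 ≤ τ` and `C η ≤ τ e` satisfies `⟨a, η⟩ ≤ τ κ`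
  have key := farkas_finset (V := (ι → ℝ) × ℝ) (κ := Option ρ) Finset.univ
    (fun o => o.elim (-LinearMap.snd ℝ _ _)
      (fun k => (LinearMap.proj k ∘ₗ C.mulVecLin) ∘ₗ LinearMap.fst ℝ _ _
        - e k • LinearMap.snd ℝ _ _))
    ((dotProductBilin ℝ ℝ a) ∘ₗ LinearMap.fst ℝ _ _ - κ • LinearMap.snd ℝ _ _) ?_
  · obtain ⟨γ, hγ, hb⟩ := key
    refine ⟨fun k => γ (some k), fun k => hγ _, ?_, ?_⟩
    · funext q
      have := LinearMap.congr_fun hb (Pi.single q 1, 0)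
      simp [Fintype.sum_option, dotProductBilin] at this
      rw [this]
      simp [Matrix.mulVec, dotProduct, mul_comm]
    · have := LinearMap.congr_fun hb (0, 1)
      simp [Fintype.sum_option, dotProductBilin] at this
      have h0 := hγ none
      simp only [dotProduct]
      linarith
  · rintro ⟨η, τ⟩ hx
    have hτ : 0 ≤ τ := by simpa using hx none (Finset.mem_univ _)
    have hk : ∀ k, (C *ᵥ η) k ≤ e k * τ := fun k => by
      simpa using hx (some k) (Finset.mem_univ _)
    suffices a ⬝ᵥ η ≤ κ * τ by simpa [dotProductBilin] using this
    rcases hτ.eq_or_lt with rfl | hτ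
    · -- a recession direction: all its multiples are feasible
      by_contra hpos
      push Not at hpos
      rw [mul_zero] at hpos
      have := h (((|κ| + 1) / (a ⬝ᵥ η)) • η) (fun k => by
        rw [Matrix.mulVec_smul, Pi.smul_apply, smul_eq_mul]
        refine le_trans (mul_nonpos_of_nonneg_of_nonpos (by positivity) ?_) (he k)
        simpa using hk k)
      rw [dotProduct_smul, smul_eq_mul, div_mul_cancel₀ _ hpos.ne'] at this
      linarith [le_abs_self κ]
    · have := h (τ⁻¹ • η) (fun k => by
        rw [Matrix.mulVec_smul, Pi.smul_apply, smul_eq_mul, inv_mul_le_iff₀ hτ, mul_comm]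
        exact hk k)
      rw [dotProduct_smul, smul_eq_mul, inv_mul_le_iff₀ hτ] at this
      linarith

/-! ### The dual norm and conic duality -/

section DualNorm

variable {ι : Type*} [Fintype ι]

theorem continuous_seminorm_pi (p : Seminorm ℝ (ι → ℝ)) : Continuous p := by
  classical
  have := p.convexOn.continuousOn (isOpen_univ)
  exact continuousOn_univ.1 this

theorem exists_norm_le_mul_seminorm {p : Seminorm ℝ (ι → ℝ)} (hp : ∀ ξ, p ξ = 0 → ξ = 0) :
    ∃ c : ℝ, 0 ≤ c ∧ ∀ ξ, ‖ξ‖ ≤ c * p ξ := by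
  rcases (Metric.sphere (0 : ι → ℝ) 1).eq_empty_or_nonempty with hs | hs
  · refine ⟨0, le_rfl, fun ξ => ?_⟩
    by_contra hξ
    rw [zero_mul, not_le] at hξ
    have : (‖ξ‖⁻¹ • ξ) ∈ Metric.sphere (0 : ι → ℝ) 1 := by
      simp [norm_smul, hξ.ne']
    simp [hs] at this
  · obtain ⟨ζ, hζ, hmin⟩ := (isCompact_sphere (0 : ι → ℝ) 1).exists_isMinOn hs
      (continuous_seminorm_pi p).continuousOn
    have hζ0 : 0 < p ζ := (apply_nonneg p ζ).lt_of_ne fun h0 => by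
      have := hp ζ h0.symm
      simp [this] at hζ
    refine ⟨(p ζ)⁻¹, by positivity, fun ξ => ?_⟩
    rcases eq_or_ne ξ 0 with rfl | hξ
    · simp
    have hξ : 0 < ‖ξ‖ := norm_pos_iff.2 hξ
    have h1 : p ζ ≤ p (‖ξ‖⁻¹ • ξ) := hmin (by simp [norm_smul, hξ.ne'])
    rw [map_smul_eq_mul, norm_inv, norm_norm, le_inv_mul_iff₀ hξ, mul_comm] at h1
    rwa [le_inv_mul_iff₀ hζ0]

theorem bddAbove_dualNorm {p : Seminorm ℝ (ι → ℝ)} (hp : ∀ ξ, p ξ = 0 → ξ = 0) (z : ι → ℝ) :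
    BddAbove {r : ℝ | ∃ ξ : ι → ℝ, p ξ ≤ 1 ∧ r = z ⬝ᵥ ξ} := by
  obtain ⟨c, hc, h⟩ := exists_norm_le_mul_seminorm hp
  refine ⟨∑ i, |z i| * c, ?_⟩
  rintro _ ⟨ξ, hξ, rfl⟩
  refine Finset.sum_le_sum fun i _ => ?_
  calc z i * ξ i ≤ |z i| * |ξ i| := by rw [← abs_mul]; exact le_abs_self _
    _ ≤ |z i| * c := by
      refine mul_le_mul_of_nonneg_left ?_ (abs_nonneg _)
      exact (norm_le_pi_norm ξ i).trans ((h ξ).trans (mul_le_of_le_one_right hc hξ))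

theorem dualNorm_nonneg {p : Seminorm ℝ (ι → ℝ)} (hp : ∀ ξ, p ξ = 0 → ξ = 0) (z : ι → ℝ) :
    0 ≤ dualNorm p z :=
  le_csSup (bddAbove_dualNorm hp z) ⟨0, by simp⟩

theorem dualNorm_le {p : Seminorm ℝ (ι → ℝ)} {z : ι → ℝ} {l : ℝ}
    (h : ∀ ξ, p ξ ≤ 1 → z ⬝ᵥ ξ ≤ l) : dualNorm p z ≤ l := by
  refine csSup_le ⟨0, 0, by simp⟩ ?_
  rintro _ ⟨ξ, hξ, rfl⟩
  exact h ξ hξ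

theorem dotProduct_le_dualNorm_mul {p : Seminorm ℝ (ι → ℝ)} (hp : ∀ ξ, p ξ = 0 → ξ = 0)
    (z ξ : ι → ℝ) : z ⬝ᵥ ξ ≤ dualNorm p z * p ξ := by
  rcases (apply_nonneg p ξ).eq_or_lt with h0 | h0
  · simp [hp ξ h0.symm]
  have := le_csSup (bddAbove_dualNorm hp z) ⟨(p ξ)⁻¹ • ξ, by
    rw [map_smul_eq_mul, norm_inv, Real.norm_of_nonneg h0.le, inv_mul_cancel₀ h0.ne'], rfl⟩
  rw [dotProduct_smul, smul_eq_mul, inv_mul_le_iff₀ h0, mul_comm] at this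
  exact this

theorem dualNorm_convexComb_le {p : Seminorm ℝ (ι → ℝ)} (hp : ∀ ξ, p ξ = 0 → ξ = 0)
    (z z' : ι → ℝ) {θ θ' : ℝ} (hθ : 0 ≤ θ) (hθ' : 0 ≤ θ') :
    dualNorm p (θ • z + θ' • z') ≤ θ * dualNorm p z + θ' * dualNorm p z' := by
  refine dualNorm_le fun ξ hξ => ?_
  rw [add_dotProduct, smul_dotProduct, smul_dotProduct, smul_eq_mul, smul_eq_mul]
  have h (y : ι → ℝ) : y ⬝ᵥ ξ ≤ dualNorm p y :=
    le_csSup (bddAbove_dualNorm hp y) ⟨ξ, hξ, rfl⟩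
  exact add_le_add (mul_le_mul_of_nonneg_left (h z) hθ) (mul_le_mul_of_nonneg_left (h z') hθ')

/-- An affine function `a - κ` on a convex set `X` that lies below `l * p` is separated from it by a
linear functional `z`. No interior point of `X` is needed, as `p` is finite and continuous
everywhere. -/
theorem exists_minorant (p : Seminorm ℝ (ι → ℝ)) {X : Set (ι → ℝ)} (hX : Convex ℝ X)
    (h0 : (0 : ι → ℝ) ∈ X) (a : ι → ℝ) {l κ : ℝ} (hl : 0 ≤ l)
    (h : ∀ η ∈ X, a ⬝ᵥ η - l * p η ≤ κ) :
    ∃ z : ι → ℝ, (∀ η, z ⬝ᵥ η ≤ l * p η) ∧ ∀ η ∈ X, (a - z) ⬝ᵥ η ≤ κ := by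
  classical
  -- separate the strict epigraph of `l * p` from the hypograph of `a - κ` over `X`
  have hs₁ : Convex ℝ {x : (ι → ℝ) × ℝ | l * p x.1 < x.2} := by
    have : ConvexOn ℝ Set.univ (fun η => l * p η) := p.convexOn.smul hl
    simpa using this.convex_strict_epigraph
  have hs₂ : IsOpen {x : (ι → ℝ) × ℝ | l * p x.1 < x.2} :=
    isOpen_lt (continuous_const.mul ((continuous_seminorm_pi p).comp continuous_fst))
      continuous_snd
  have ht : Convex ℝ {x : (ι → ℝ) × ℝ | x.1 ∈ X ∧ x.2 ≤ a ⬝ᵥ x.1 - κ} := by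
    rintro ⟨η, τ⟩ ⟨h1, h2⟩ ⟨η', τ'⟩ ⟨h1', h2'⟩ θ θ' hθ hθ' hsum
    refine ⟨hX h1 h1' hθ hθ' hsum, ?_⟩
    simp only [Prod.fst_add, Prod.smul_fst, Prod.snd_add, Prod.smul_snd, smul_eq_mul,
      dotProduct_add, dotProduct_smul] at h2 h2' ⊢
    have h3 := mul_le_mul_of_nonneg_left h2 hθ
    have h4 := mul_le_mul_of_nonneg_left h2' hθ'
    have h5 : κ = θ * κ + θ' * κ := by rw [← add_mul, hsum, one_mul]
    linarith
  obtain ⟨f, u, hfs, hft⟩ := geometric_hahn_banach_open hs₁ hs₂ ht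
    (Set.disjoint_left.2 fun x hx hx' => by
      have := h x.1 hx'.1
      have h1 : l * p x.1 < x.2 := hx
      linarith [hx'.2])
  have hf (η : ι → ℝ) (τ : ℝ) : f (η, τ) = f (η, 0) + τ * f (0, 1) := by
    rw [← smul_eq_mul, ← map_smul, ← map_add]
    simp
  set c : ℝ := f (0, 1)
  have hu : 0 ≤ u := by
    refine le_of_forall_pos_lt_add fun δ hδ => ?_
    have := hfs (0, δ / (|c| + 1)) (by
      change l * p 0 < _
      rw [map_zero, mul_zero]; positivity)
    rw [hf] at this
    have hz : f ((0 : ι → ℝ), (0 : ℝ)) = 0 := map_zero f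
    have h2 : -δ < δ / (|c| + 1) * c := by
      rw [div_mul_eq_mul_div, lt_div_iff₀ (by positivity)]
      nlinarith [neg_abs_le c]
    linarith
  -- the hyperplane is not vertical: above `0` lie points of both sets
  have hc : c < 0 := by
    have h1 := hfs (0, |κ| + 1) (by
      change l * p 0 < _
      rw [map_zero, mul_zero]; positivity)
    have h2 := hft (0, -κ) ⟨h0, by simp⟩
    rw [hf] at h1 h2
    nlinarith [neg_abs_le κ]
  -- the left-hand side is positively homogeneous in `η` and bounded above by `u`
  have hle (η : ι → ℝ) : f (η, 0) + l * p η * c ≤ 0 := by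
    by_contra hpos
    push Not at hpos
    set v := f (η, 0) + l * p η * c with hv
    have hK : 0 < (u + 1) / v := by positivity
    have := hfs (((u + 1) / v) • η, (u + 1) / v * (l * p η) + (-c)⁻¹) (by
      change l * p _ < _
      rw [map_smul_eq_mul, Real.norm_of_nonneg hK.le]
      have : 0 < (-c)⁻¹ := by simpa using hc
      linarith)
    rw [hf] at this
    have h3 : f (((u + 1) / v) • η, 0) = (u + 1) / v * f (η, 0) := by
      rw [← smul_eq_mul, ← map_smul]
      simp
    have h4 : (u + 1) / v * v = u + 1 := div_mul_cancel₀ _ hpos.ne'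
    have h5 : (-c)⁻¹ * c = -1 := by
      rw [inv_neg, neg_mul, inv_mul_cancel₀ hc.ne]
    rw [h3, add_mul, h5] at this
    have h6 (k : ℝ) : k * f (η, 0) + k * (l * p η) * c = k * v := by rw [hv]; ring
    linarith [h6 ((u + 1) / v)]
  have hz (η : ι → ℝ) : (fun i => (-c)⁻¹ * f (Pi.single i 1, 0)) ⬝ᵥ η = (-c)⁻¹ * f (η, 0) := by
    have : f (η, 0) = ∑ i, f (Pi.single i 1, 0) * η i := by
      have h1 : ((η, 0) : (ι → ℝ) × ℝ) = ∑ i, η i • (Pi.single i 1, (0 : ℝ)) := by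
        refine Prod.ext ?_ ?_
        · simp only [Prod.fst_sum, Prod.smul_fst]
          exact pi_eq_sum_univ' η
        · simp [Prod.snd_sum]
      rw [h1, map_sum]
      exact Finset.sum_congr rfl fun i _ => by rw [map_smul, smul_eq_mul, mul_comm]
    rw [this, dotProduct, Finset.mul_sum]
    exact Finset.sum_congr rfl fun i _ => by ring
  have hc' : 0 < -c := by linarith
  refine ⟨fun i => (-c)⁻¹ * f (Pi.single i 1, 0), fun η => ?_, fun η hη => ?_⟩
  · rw [hz, inv_mul_le_iff₀ hc']
    linarith [hle η]
  · have h1 := hft (η, a ⬝ᵥ η - κ) ⟨hη, le_rfl⟩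
    rw [hf] at h1
    rw [sub_dotProduct, hz]
    have h2 : a ⬝ᵥ η - κ ≤ (-c)⁻¹ * f (η, 0) := by
      rw [le_inv_mul_iff₀ hc']
      linarith
    linarith

/-- Strong duality, with attainment, for the maximum of `⟨a, η⟩ - l * p η` over the polyhedron
`C η ≤ e`. -/
theorem exists_multiplier {ρ : Type*} [Fintype ρ] (p : Seminorm ℝ (ι → ℝ))
    (C : Matrix ρ ι ℝ) {e : ρ → ℝ} (he : ∀ k, 0 ≤ e k) (a : ι → ℝ) {l κ : ℝ} (hl : 0 ≤ l)
    (h : ∀ η, (∀ k, (C *ᵥ η) k ≤ e k) → a ⬝ᵥ η - l * p η ≤ κ) :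
    ∃ γ : ρ → ℝ, (∀ k, 0 ≤ γ k) ∧ γ ⬝ᵥ e ≤ κ ∧ dualNorm p (Cᵀ *ᵥ γ - a) ≤ l := by
  have hX : Convex ℝ (uncertaintySet C e) := by
    intro η hη η' hη' θ θ' hθ hθ' hsum k
    have h3 := mul_le_mul_of_nonneg_left (hη k) hθ
    have h4 := mul_le_mul_of_nonneg_left (hη' k) hθ'
    have h5 : e k = θ * e k + θ' * e k := by rw [← add_mul, hsum, one_mul]
    simp only [Matrix.mulVec_add, Matrix.mulVec_smul, Pi.add_apply, Pi.smul_apply, smul_eq_mul]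
    linarith
  obtain ⟨z, hz, hza⟩ := exists_minorant p hX (fun k => by simpa using he k) a hl h
  obtain ⟨γ, hγ, hγa, hγe⟩ := affine_farkas C he (a - z) κ hza
  refine ⟨γ, hγ, hγe, dualNorm_le fun ξ hξ => ?_⟩
  have h1 := hz (-ξ)
  rw [map_neg_eq_map, dotProduct_neg] at h1
  rw [hγa, sub_sub_cancel_left, neg_dotProduct]
  exact h1.trans (mul_le_of_le_one_right hl hξ)

end DualNorm

/-! ### The closed loop as an affine function of the disturbances -/

/-- The variation-of-constants formula for `z (t + 1) = A z t + w t`. -/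
theorem linear_recursion_eq {n : ℕ} (A : Matrix (Fin n) (Fin n) ℝ) (z w : ℕ → Fin n → ℝ)
    (h : ∀ t, z (t + 1) = A *ᵥ z t + w t) (t : ℕ) :
    z t = A ^ t *ᵥ z 0 + ∑ τ ∈ Finset.range t, A ^ (t - 1 - τ) *ᵥ w τ := by
  induction t with
  | zero => simp
  | succ t ih =>
    rw [h, ih, Matrix.mulVec_add, Matrix.mulVec_mulVec, ← pow_succ', Finset.sum_range_succ,
      Matrix.mulVec_sum, add_assoc]
    congr 2
    · refine Finset.sum_congr rfl fun τ hτ => ?_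
      have := Finset.mem_range.1 hτ
      rw [Matrix.mulVec_mulVec, ← pow_succ']
      congr 2
      omega
    · simp

theorem sum_range_eq_sum_fin {N t : ℕ} (ht : t ≤ N) (f : ℕ → ℝ) :
    ∑ τ ∈ Finset.range t, f τ = ∑ τ : Fin N, if τ.val < t then f τ else 0 := by
  rw [Fin.sum_univ_eq_sum_range (fun τ => if τ < t then f τ else 0) N, ← Finset.sum_filter]
  refine Finset.sum_congr ?_ fun _ _ => rfl
  ext τ
  simp only [Finset.mem_range, Finset.mem_filter]
  omega

/-- The convolution sum of the variation-of-constants formula as a row of a strictly lower block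
triangular matrix; this is how `A`-powers enter `B_x`, `C_x` and `C_y`. -/
theorem convolution_mulVec {N n k : ℕ} (M : ℕ → Matrix (Fin n) (Fin k) ℝ)
    (v : Fin N × Fin k → ℝ) {t : ℕ} (w : ℕ → Fin k → ℝ)
    (hw : ∀ τ : Fin N, w τ = fun i => v (τ, i)) (ht : t ≤ N) (a : Fin n) :
    (∑ τ ∈ Finset.range t, M τ *ᵥ w τ) a =
      ∑ b : Fin N × Fin k, (if b.1.val < t then M b.1 a b.2 else 0) * v b := by
  rw [Finset.sum_apply, sum_range_eq_sum_fin ht, Fintype.sum_prod_type]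
  refine Finset.sum_congr rfl fun τ _ => ?_
  split_ifs with h
  · rw [hw]; rfl
  · simp

theorem disturbance_eq {N nw : ℕ} (ξ : Fin N × Fin nw → ℝ) (t : Fin N) :
    disturbance ξ t = fun i => ξ (t, i) := by
  funext i
  simp [disturbance]

theorem dotProduct_conj_mulVec {l k : Type*} [Fintype l] [Fintype k] (K : Matrix l k ℝ)
    (J : Matrix l l ℝ) (v : k → ℝ) : v ⬝ᵥ (Kᵀ * J * K) *ᵥ v = (K *ᵥ v) ⬝ᵥ J *ᵥ (K *ᵥ v) := by
  rw [Matrix.mul_assoc, ← Matrix.mulVec_mulVec, ← Matrix.mulVec_mulVec, Matrix.mulVec_transpose,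
    dotProduct_comm, ← Matrix.dotProduct_mulVec, dotProduct_comm]

/-- A nonnegative quadratic form is convex; the matrix need not be symmetric, as the defect of
convexity is `θ θ'` times the value at `y - y'`. -/
theorem quadratic_convexComb_le {l : Type*} [Fintype l] (J : Matrix l l ℝ)
    (hJ : ∀ y : l → ℝ, 0 ≤ y ⬝ᵥ J *ᵥ y) (y y' : l → ℝ) {θ θ' : ℝ} (hθ : 0 ≤ θ) (hθ' : 0 ≤ θ')
    (h : θ + θ' = 1) :
    (θ • y + θ' • y') ⬝ᵥ J *ᵥ (θ • y + θ' • y') ≤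
      θ * (y ⬝ᵥ J *ᵥ y) + θ' * (y' ⬝ᵥ J *ᵥ y') := by
  have h1 := mul_nonneg (mul_nonneg hθ hθ') (hJ (y - y'))
  obtain rfl : θ' = 1 - θ := by linarith
  simp only [Matrix.mulVec_add, Matrix.mulVec_sub, Matrix.mulVec_smul, dotProduct_add,
    add_dotProduct, sub_dotProduct, dotProduct_sub, dotProduct_smul, smul_dotProduct,
    smul_eq_mul] at h1 ⊢
  linarith

/-- The extended disturbance sequence `[1; ξ]`. -/
def extend {ι : Type*} (ξ : ι → ℝ) : Unit ⊕ ι → ℝ := Sum.elim (fun _ => 1) ξ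

namespace Problem

variable {nx nu ny nw N Ns Nb r : ℕ} (P : Problem nx nu ny nw N Ns Nb r)

/-- The stacked purified outputs, preceded by `1`, are `(C̃_y + Ẽ_y) [1; ξ]`. They do not depend on the
control law, which makes the closed loop affine in `H`. -/
theorem purified_eq_mulVec (ξ : Fin N × Fin nw → ℝ) (t : Fin N) (j : Fin ny) :
    purified P.sys P.x₀ ξ t j = ((P.Cyt + P.Eyt) *ᵥ extend ξ) (Sum.inr (t, j)) := by
  have h1 := linear_recursion_eq P.sys.A (discrepancy P.sys P.x₀ ξ)
    (fun t => P.sys.C *ᵥ disturbance ξ t) (fun _ => rfl) t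
  have h2 : (P.Cyt + P.Eyt) *ᵥ extend ξ =
      Sum.elim (fun _ => 1) (P.Ay *ᵥ P.x₀ + P.Cy *ᵥ ξ + P.Ey *ᵥ ξ) := by
    rw [Matrix.add_mulVec, Cyt, Eyt, extend, Matrix.fromBlocks_mulVec, Matrix.fromBlocks_mulVec]
    ext (q | q)
    · simp
    · simp [Matrix.mulVec, dotProduct]
  rw [h2, Sum.elim_inr, purified, h1, Matrix.mulVec_add, Matrix.mulVec_sum]
  simp only [Matrix.mulVec_mulVec, Pi.add_apply]
  congr 1
  · congr 1
    rw [convolution_mulVec _ ξ _ (disturbance_eq ξ) t.2.le]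
    simp only [Cy, Matrix.mulVec, dotProduct, Matrix.of_apply, Matrix.mul_assoc]
  · rw [disturbance_eq]
    simp only [Ey, Matrix.mulVec, dotProduct, Matrix.kroneckerMap_apply, Fintype.sum_prod_type,
      Matrix.one_apply]
    rw [Finset.sum_eq_single t]
    · simp
    · intro b _ hb
      simp [hb.symm]
    · simp

theorem input_eq_mulVec {H : LawMatrix N nu ny} (hH : IsCausal H) (ξ : Fin N × Fin nw → ℝ)
    (t : Fin N) (i : Fin nu) :
    input P.sys P.x₀ H ξ t i = (P.Ht H *ᵥ extend ξ) (t, i) := by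
  have h1 : ((P.Cyt + P.Eyt) *ᵥ extend ξ) (Sum.inl ()) = 1 := by
    simp [Matrix.add_mulVec, Cyt, Eyt, extend, Matrix.fromBlocks_mulVec]
  rw [Ht, ← Matrix.mulVec_mulVec, Matrix.mulVec, dotProduct, Fintype.sum_sum_type, input,
    dif_pos t.2]
  simp only [Finset.univ_unique, Finset.sum_singleton, Fintype.sum_prod_type]
  congr 1
  · rw [show (default : Unit) = () from rfl, h1, mul_one]
  · rw [Finset.sum_filter]
    refine Finset.sum_congr rfl fun τ _ => ?_
    split_ifs with h
    · exact Finset.sum_congr rfl fun j _ => by rw [purified_eq_mulVec]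
    · exact (Finset.sum_eq_zero fun j _ => by
        rw [hH t τ i j (Fin.lt_def.2 (not_le.1 h)), zero_mul]).symm

theorem state_eq_mulVec {H : LawMatrix N nu ny} (hH : IsCausal H) (ξ : Fin N × Fin nw → ℝ)
    (t : Fin (N + 1)) (m : Fin nx) :
    state P.sys P.x₀ H ξ t m = (P.K H *ᵥ extend ξ) (t, m) := by
  have h1 := linear_recursion_eq P.sys.A (state P.sys P.x₀ H ξ)
    (fun t => P.sys.B *ᵥ input P.sys P.x₀ H ξ t + P.sys.C *ᵥ disturbance ξ t)
    (fun t => by rw [state, add_assoc]) t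
  have ht : t.val ≤ N := Nat.lt_succ_iff.1 t.2
  have h2 : P.Cxt *ᵥ extend ξ = P.Ax *ᵥ P.x₀ + P.Cx *ᵥ ξ := by
    rw [Cxt, extend, Matrix.fromCols_mulVec]
    ext q
    simp [Matrix.mulVec, dotProduct]
  rw [K, Matrix.add_mulVec, h2, h1]
  simp only [Matrix.mulVec_add, Finset.sum_add_distrib, Matrix.mulVec_mulVec, Pi.add_apply]
  rw [← Matrix.mulVec_mulVec _ P.Bx, convolution_mulVec _ ξ _ (disturbance_eq ξ) ht,
    convolution_mulVec _ (P.Ht H *ᵥ extend ξ) _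
      (fun τ => funext fun i => P.input_eq_mulVec hH ξ τ i) ht]
  have h3 : (P.Ax *ᵥ P.x₀) (t, m) = (P.sys.A ^ t.val *ᵥ P.x₀) m := rfl
  have h4 : (P.Cx *ᵥ ξ) (t, m) = ∑ b : Fin N × Fin nw,
      (if b.1.val < t.val then (P.sys.A ^ (t.val - 1 - b.1.val) * P.sys.C) m b.2 else 0) * ξ b :=
    rfl
  rw [h3, h4, add_assoc, add_comm (∑ b, _)]
  rfl

/-- The constraint function is a maximum of affine functions of the disturbances. -/
theorem loss_eq {H : LawMatrix N nu ny} (hH : IsCausal H) (ξ : Fin N × Fin nw → ℝ) (j : Fin Nb) :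
    loss P.sys P.x₀ H ξ (P.g j) = ⨆ t : Fin N, (P.bVal H t j + P.aVec H t j ⬝ᵥ ξ) := by
  refine iSup_congr fun t => ?_
  have h1 : P.g j ⬝ᵥ state P.sys P.x₀ H ξ (t.val + 1) =
      ∑ m, P.g j m * (P.K H *ᵥ extend ξ) (t.succ, m) :=
    Finset.sum_congr rfl fun m _ => by rw [← P.state_eq_mulVec hH]; rfl
  rw [h1]
  simp only [bVal, aVec, Matrix.mulVec, dotProduct, Fintype.sum_sum_type, extend, Sum.elim_inl, Sum.elim_inr,
    mul_add, Finset.sum_add_distrib, Finset.univ_unique, Finset.sum_singleton, mul_one]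
  congr 1
  simp only [Finset.mul_sum, Finset.sum_mul]
  rw [Finset.sum_comm]
  exact Finset.sum_congr rfl fun _ _ => Finset.sum_congr rfl fun _ _ => by ring

theorem dotProduct_Jx_mulVec (y : Fin (N + 1) × Fin nx → ℝ) :
    y ⬝ᵥ P.Jx *ᵥ y = ∑ t : Fin (N + 1), P.β ^ t.val * ((fun m => y (t, m)) ⬝ᵥ
      (if t.val < N then P.Q else P.Qf) *ᵥ fun m => y (t, m)) := by
  simp only [Matrix.mulVec, dotProduct, Fintype.sum_prod_type, Jx, Matrix.of_apply, Finset.mul_sum]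
  refine Finset.sum_congr rfl fun t _ => Finset.sum_congr rfl fun m _ => ?_
  rw [Finset.sum_eq_single t]
  · refine Finset.sum_congr rfl fun m' _ => ?_
    split_ifs <;> simp_all <;> ring
  · intro t' _ h
    simp [h.symm]
  · simp

theorem dotProduct_Ju_mulVec (y : Fin N × Fin nu → ℝ) :
    y ⬝ᵥ P.Ju *ᵥ y = ∑ t : Fin N, P.β ^ t.val * ((fun m => y (t, m)) ⬝ᵥ
      P.R *ᵥ fun m => y (t, m)) := by
  simp only [Matrix.mulVec, dotProduct, Fintype.sum_prod_type, Ju, Matrix.kroneckerMap_apply,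
    Finset.mul_sum]
  refine Finset.sum_congr rfl fun t _ => Finset.sum_congr rfl fun m _ => ?_
  rw [Finset.sum_eq_single t]
  · refine Finset.sum_congr rfl fun m' _ => ?_
    rw [Matrix.diagonal_apply_eq]
    ring
  · intro t' _ h
    simp [Matrix.diagonal_apply_ne' _ h]
  · simp

theorem cost_eq {H : LawMatrix N nu ny} (hH : IsCausal H) (ξ : Fin N × Fin nw → ℝ) :
    cost P.sys P.x₀ H ξ P.β P.Q P.Qf P.R = extend ξ ⬝ᵥ P.costMatrix H *ᵥ extend ξ := by
  rw [costMatrix, Matrix.add_mulVec, dotProduct_add, dotProduct_conj_mulVec,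
    dotProduct_conj_mulVec, dotProduct_Jx_mulVec, dotProduct_Ju_mulVec]
  simp only [← P.state_eq_mulVec hH, ← P.input_eq_mulVec hH]
  rw [cost, Fin.sum_univ_castSucc, Finset.sum_range]
  simp only [mul_add, Finset.sum_add_distrib, Fin.val_castSucc, Fin.val_last, Fin.is_lt, if_true,
    lt_irrefl, if_false]
  ring

end Problem

/-! ### The expected cost -/

namespace Problem

variable {nx nu ny nw N Ns Nb r : ℕ} (P : Problem nx nu ny nw N Ns Nb r)

section Moments

variable {ν : Measure (Fin N × Fin nw → ℝ)} [IsProbabilityMeasure ν]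
  (hν : IsIIDWithMoments ν P.μw P.Sw)
include hν

theorem memLp_extend (a : Unit ⊕ Fin N × Fin nw) : MemLp (fun ξ => extend ξ a) 2 ν := by
  rcases a with a | ⟨t, i⟩
  · exact memLp_const 1
  · exact hν.memLp t i

theorem integral_extend (a : Unit ⊕ Fin N × Fin nw) : ∫ ξ, extend ξ a ∂ν = P.meanExt a := by
  rcases a with a | ⟨t, i⟩
  · simp [extend, meanExt]
  · exact hν.mean t i

theorem covariance_extend (a b : Unit ⊕ Fin N × Fin nw) :
    covariance (fun ξ => extend ξ a) (fun ξ => extend ξ b) ν = P.covExt a b := by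
  rcases a with a | ⟨t, i⟩
  · simp only [extend, Sum.elim_inl, covariance_const_left]
    rcases b with b | b <;> simp [covExt]
  rcases b with b | ⟨t', i'⟩
  · simp [extend, Sum.elim_inl, covariance_const_right, covExt]
  simp only [extend, Sum.elim_inr, covExt, Matrix.fromBlocks_apply₂₂, Matrix.kroneckerMap_apply,
    Matrix.one_apply]
  split_ifs with h
  · subst h
    rw [hν.cov, one_mul]
  · rw [zero_mul]
    exact ((hν.indep.indepFun h).comp (measurable_pi_apply i)
      (measurable_pi_apply i')).covariance_eq_zero (hν.memLp t i) (hν.memLp t' i')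

theorem integral_extend_mul (a b : Unit ⊕ Fin N × Fin nw) :
    ∫ ξ, extend ξ a * extend ξ b ∂ν = P.covExt a b + P.meanExt a * P.meanExt b := by
  have h := covariance_eq_sub (P.memLp_extend hν a) (P.memLp_extend hν b)
  rw [P.covariance_extend hν, P.integral_extend hν, P.integral_extend hν] at h
  rw [h]
  simp

theorem integrable_quadratic (M : Matrix (Unit ⊕ Fin N × Fin nw) (Unit ⊕ Fin N × Fin nw) ℝ) :
    Integrable (fun ξ => extend ξ ⬝ᵥ M *ᵥ extend ξ) ν := by
  simp only [dotProduct, Matrix.mulVec, Finset.mul_sum]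
  refine integrable_finsetSum _ fun a _ => integrable_finsetSum _ fun b _ => ?_
  have := ((P.memLp_extend hν a).integrable_mul (P.memLp_extend hν b)).const_mul (M a b)
  refine this.congr (Filter.Eventually.of_forall fun ξ => ?_)
  simp only [Pi.mul_apply]
  ring

theorem integral_quadratic (M : Matrix (Unit ⊕ Fin N × Fin nw) (Unit ⊕ Fin N × Fin nw) ℝ) :
    ∫ ξ, extend ξ ⬝ᵥ M *ᵥ extend ξ ∂ν =
      (M * P.covExt).trace + P.meanExt ⬝ᵥ M *ᵥ P.meanExt := by
  have hint (a b : Unit ⊕ Fin N × Fin nw) :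
      Integrable (fun ξ => M a b * (extend ξ b * extend ξ a)) ν :=
    ((P.memLp_extend hν b).integrable_mul (P.memLp_extend hν a)).const_mul (M a b)
  have h (ξ : Fin N × Fin nw → ℝ) : extend ξ ⬝ᵥ M *ᵥ extend ξ =
      ∑ a, ∑ b, M a b * (extend ξ b * extend ξ a) := by
    simp only [dotProduct, Matrix.mulVec, Finset.mul_sum]
    exact Finset.sum_congr rfl fun a _ => Finset.sum_congr rfl fun b _ => by ring
  simp only [h]
  rw [integral_finsetSum _ fun a _ => integrable_finsetSum _ fun b _ => hint a b]
  simp only [Matrix.trace, Matrix.diag, Matrix.mul_apply, dotProduct, Matrix.mulVec,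
    Finset.mul_sum, ← Finset.sum_add_distrib]
  refine Finset.sum_congr rfl fun a _ => ?_
  rw [integral_finsetSum _ fun b _ => hint a b]
  refine Finset.sum_congr rfl fun b _ => ?_
  rw [integral_const_mul, P.integral_extend_mul hν]
  ring

/-- The expected cost depends on the distribution only through its mean and covariance matrix. -/
theorem expectedCost_eq {H : LawMatrix N nu ny} (hH : IsCausal H) :
    P.expectedCost H ν = P.coneObjective H := by
  simp only [expectedCost, P.cost_eq hH, P.integral_quadratic hν, coneObjective]

end Moments

theorem objectiveInf_eq (hiid : P.iidBall.Nonempty) {H : LawMatrix N nu ny} (hH : IsCausal H) :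
    P.objectiveInf H = (P.coneObjective H : EReal) := by
  have h (ν) (hν : ν ∈ P.iidBall) : (P.expectedCost H ν : EReal) = P.coneObjective H := by
    have := hν.1.1.1
    rw [P.expectedCost_eq hν.2 hH]
  rw [objectiveInf, biInf_congr h, biInf_const hiid]

theorem objectiveSup_eq (hiid : P.iidBall.Nonempty) {H : LawMatrix N nu ny} (hH : IsCausal H) :
    P.objectiveSup H = (P.coneObjective H : EReal) := by
  have h (ν) (hν : ν ∈ P.iidBall) : (P.expectedCost H ν : EReal) = P.coneObjective H := by
    have := hν.1.1.1
    rw [P.expectedCost_eq hν.2 hH]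
  rw [objectiveSup, biSup_congr h, biSup_const hiid]

/-! ### Convexity of the cone program -/

theorem Ht_convexComb (H H' : LawMatrix N nu ny) (θ θ' : ℝ) :
    P.Ht (θ • H + θ' • H') = θ • P.Ht H + θ' • P.Ht H' := by
  simp only [Ht, Matrix.add_mul, Matrix.smul_mul]

theorem K_convexComb (H H' : LawMatrix N nu ny) {θ θ' : ℝ} (h : θ + θ' = 1) :
    P.K (θ • H + θ' • H') = θ • P.K H + θ' • P.K H' := by
  have : P.Cxt = θ • P.Cxt + θ' • P.Cxt := by rw [← add_smul, h, one_smul]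
  rw [K, Ht_convexComb, this]
  simp only [K, Matrix.mul_add, Matrix.mul_smul, smul_add]
  abel

theorem aVec_convexComb (H H' : LawMatrix N nu ny) {θ θ' : ℝ} (h : θ + θ' = 1) (t : Fin N)
    (j : Fin Nb) : P.aVec (θ • H + θ' • H') t j = θ • P.aVec H t j + θ' • P.aVec H' t j := by
  funext q
  simp only [aVec, K_convexComb P H H' h, Pi.add_apply, Pi.smul_apply, Matrix.add_apply,
    Matrix.smul_apply, smul_eq_mul, Finset.mul_sum, ← Finset.sum_add_distrib]
  exact Finset.sum_congr rfl fun _ _ => by ring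

theorem bVal_convexComb (H H' : LawMatrix N nu ny) {θ θ' : ℝ} (h : θ + θ' = 1) (t : Fin N)
    (j : Fin Nb) : P.bVal (θ • H + θ' • H') t j = θ * P.bVal H t j + θ' * P.bVal H' t j := by
  simp only [bVal, K_convexComb P H H' h, Matrix.add_apply,
    Matrix.smul_apply, smul_eq_mul, Finset.mul_sum, ← Finset.sum_add_distrib]
  exact Finset.sum_congr rfl fun _ _ => by ring

theorem dotProduct_Jx_nonneg (hβ : 0 < P.β) (hQ : P.Q.PosSemidef) (hQf : P.Qf.PosSemidef)
    (y : Fin (N + 1) × Fin nx → ℝ) : 0 ≤ y ⬝ᵥ P.Jx *ᵥ y := by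
  rw [dotProduct_Jx_mulVec]
  refine Finset.sum_nonneg fun t _ => mul_nonneg (pow_nonneg hβ.le _) ?_
  split_ifs
  · simpa using hQ.dotProduct_mulVec_nonneg fun m => y (t, m)
  · simpa using hQf.dotProduct_mulVec_nonneg fun m => y (t, m)

theorem dotProduct_Ju_nonneg (hβ : 0 < P.β) (hR : P.R.PosDef)
    (y : Fin N × Fin nu → ℝ) : 0 ≤ y ⬝ᵥ P.Ju *ᵥ y := by
  rw [dotProduct_Ju_mulVec]
  refine Finset.sum_nonneg fun t _ => mul_nonneg (pow_nonneg hβ.le _) ?_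
  simpa using hR.posSemidef.dotProduct_mulVec_nonneg fun m => y (t, m)

theorem costMatrix_quadratic_convexComb_le (hβ : 0 < P.β) (hQ : P.Q.PosSemidef)
    (hQf : P.Qf.PosSemidef) (hR : P.R.PosDef) (H H' : LawMatrix N nu ny) {θ θ' : ℝ}
    (hθ : 0 ≤ θ) (hθ' : 0 ≤ θ') (h : θ + θ' = 1) (v : Unit ⊕ Fin N × Fin nw → ℝ) :
    v ⬝ᵥ P.costMatrix (θ • H + θ' • H') *ᵥ v ≤
      θ * (v ⬝ᵥ P.costMatrix H *ᵥ v) + θ' * (v ⬝ᵥ P.costMatrix H' *ᵥ v) := by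
  simp only [costMatrix, Matrix.add_mulVec, dotProduct_add, dotProduct_conj_mulVec]
  rw [P.K_convexComb H H' h, P.Ht_convexComb]
  simp only [Matrix.add_mulVec, Matrix.smul_mulVec]
  have h1 := quadratic_convexComb_le P.Jx (P.dotProduct_Jx_nonneg hβ hQ hQf)
    (P.K H *ᵥ v) (P.K H' *ᵥ v) hθ hθ' h
  have h2 := quadratic_convexComb_le P.Ju (P.dotProduct_Ju_nonneg hβ hR)
    (P.Ht H *ᵥ v) (P.Ht H' *ᵥ v) hθ hθ' h
  linarith

/-- The objective is the expected cost under any distribution in `iidBall`, and the cost is convex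
in `H` for every disturbance sequence. -/
theorem coneObjective_convexComb_le (hβ : 0 < P.β) (hQ : P.Q.PosSemidef)
    (hQf : P.Qf.PosSemidef) (hR : P.R.PosDef) (hiid : P.iidBall.Nonempty)
    (H H' : LawMatrix N nu ny) {θ θ' : ℝ} (hθ : 0 ≤ θ) (hθ' : 0 ≤ θ') (h : θ + θ' = 1) :
    P.coneObjective (θ • H + θ' • H') ≤ θ * P.coneObjective H + θ' * P.coneObjective H' := by
  obtain ⟨ν, hν, hiid⟩ := hiid
  have := hν.1.1
  simp only [coneObjective, ← P.integral_quadratic hiid]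
  rw [← integral_const_mul, ← integral_const_mul, ← integral_add
    ((P.integrable_quadratic hiid _).const_mul _) ((P.integrable_quadratic hiid _).const_mul _)]
  exact integral_mono (P.integrable_quadratic hiid _)
    (((P.integrable_quadratic hiid _).const_mul _).add
      ((P.integrable_quadratic hiid _).const_mul _))
    fun ξ => P.costMatrix_quadratic_convexComb_le hβ hQ hQf hR H H' hθ hθ' h _

theorem convex_coneFeasible (hp : ∀ ξ, P.p ξ = 0 → ξ = 0) : Convex ℝ P.coneFeasible := by
  rintro ⟨H, l, s, γ⟩ ⟨h1, h2, h3, h4, h5⟩ ⟨H', l', s', γ'⟩ ⟨h1', h2', h3', h4', h5'⟩ θ θ' hθ hθ' h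
  refine ⟨fun t τ i j hτ => ?_, fun j => ?_, fun i j t => ?_, fun i j t => ?_, fun i j t k => ?_⟩
  · change θ * H _ _ + θ' * H' _ _ = 0
    rw [h1 t τ i j hτ, h1' t τ i j hτ]
    simp
  · change (θ * l j + θ' * l' j) * P.ε + 1 / (Ns : ℝ) * ∑ i, (θ * s i j + θ' * s' i j) ≤ P.U j
    have e1 := mul_le_mul_of_nonneg_left (h2 j) hθ
    have e2 := mul_le_mul_of_nonneg_left (h2' j) hθ'
    have e3 : P.U j = θ * P.U j + θ' * P.U j := by rw [← add_mul, h, one_mul]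
    rw [Finset.sum_add_distrib, ← Finset.mul_sum, ← Finset.mul_sum]
    linarith
  · change P.bVal (θ • H + θ' • H') t j + P.aVec (θ • H + θ' • H') t j ⬝ᵥ P.ξhat i +
      (θ • γ i j t + θ' • γ' i j t) ⬝ᵥ (P.dξ - P.Cξ *ᵥ P.ξhat i) ≤ θ * s i j + θ' * s' i j
    rw [P.bVal_convexComb H H' h, P.aVec_convexComb H H' h]
    simp only [add_dotProduct, smul_dotProduct, smul_eq_mul]
    have e1 := mul_le_mul_of_nonneg_left (h3 i j t) hθ
    have e2 := mul_le_mul_of_nonneg_left (h3' i j t) hθ'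
    linarith
  · change dualNorm P.p (P.Cξᵀ *ᵥ (θ • γ i j t + θ' • γ' i j t) -
      P.aVec (θ • H + θ' • H') t j) ≤ θ * l j + θ' * l' j
    have e : P.Cξᵀ *ᵥ (θ • γ i j t + θ' • γ' i j t) - P.aVec (θ • H + θ' • H') t j =
        θ • (P.Cξᵀ *ᵥ γ i j t - P.aVec H t j) + θ' • (P.Cξᵀ *ᵥ γ' i j t - P.aVec H' t j) := by
      rw [P.aVec_convexComb H H' h, Matrix.mulVec_add, Matrix.mulVec_smul, Matrix.mulVec_smul,
        smul_sub, smul_sub]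
      abel
    rw [e]
    exact (dualNorm_convexComb_le hp _ _ hθ hθ').trans (add_le_add
      (mul_le_mul_of_nonneg_left (h4 i j t) hθ) (mul_le_mul_of_nonneg_left (h4' i j t) hθ'))
  · exact add_nonneg (mul_nonneg hθ (h5 i j t k)) (mul_nonneg hθ' (h5' i j t k))

end Problem

/-! ### Finitely supported distributions -/

section Discrete

variable {I E : Type*} [Fintype I] [MeasurableSpace E]

/-- The distribution with the weights `ω i` on the points `y i`. -/
noncomputable def discrete (ω : I → ℝ) (y : I → E) : Measure E :=
  ∑ i, ENNReal.ofReal (ω i) • Measure.dirac (y i)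

theorem map_discrete {F : Type*} [MeasurableSpace F] (ω : I → ℝ) (y : I → E) {f : E → F}
    (hf : Measurable f) : (discrete ω y).map f = discrete ω (f ∘ y) := by
  ext s hs
  simp only [discrete, Measure.map_apply hf hs, Measure.coe_finsetSum, Finset.sum_apply,
    Measure.smul_apply, Measure.dirac_apply' _ hs, Measure.dirac_apply' _ (hf hs)]
  rfl

theorem lintegral_discrete [MeasurableSingletonClass E] (ω : I → ℝ) (y : I → E) (f : E → ℝ≥0∞) :
    ∫⁻ x, f x ∂discrete ω y = ∑ i, ENNReal.ofReal (ω i) * f (y i) := by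
  simp [discrete, lintegral_finsetSum_measure, lintegral_smul_measure, lintegral_dirac]

theorem integrable_discrete [MeasurableSingletonClass E] (ω : I → ℝ) (y : I → E) (f : E → ℝ) :
    Integrable f (discrete ω y) := by
  rw [discrete, integrable_finsetSum_measure]
  exact fun i _ => (integrable_dirac (by simp)).smul_measure ENNReal.ofReal_ne_top

theorem integral_discrete [MeasurableSingletonClass E] {ω : I → ℝ} (hω : ∀ i, 0 ≤ ω i) (y : I → E)
    (f : E → ℝ) : ∫ x, f x ∂discrete ω y = ∑ i, ω i * f (y i) := by
  rw [discrete, integral_finsetSum_measure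
    fun i _ => (integrable_dirac (by simp)).smul_measure ENNReal.ofReal_ne_top]
  simp [integral_smul_measure, ENNReal.toReal_ofReal (hω _)]

theorem ae_discrete [MeasurableSingletonClass E] (ω : I → ℝ) (y : I → E) {q : E → Prop}
    (h : ∀ i, q (y i)) : ∀ᵐ x ∂discrete ω y, q x := by
  rw [discrete, ae_finsetSum_measure_iff]
  exact fun i _ => Measure.ae_smul_measure (by rw [ae_dirac_eq]; exact h i) _

end Discrete

theorem empirical_eq_discrete {ι : Type*} {Ns : ℕ} (ξhat : Fin Ns → ι → ℝ) :
    empirical ξhat = discrete (fun _ => (Ns : ℝ)⁻¹) ξhat := by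
  rcases Nat.eq_zero_or_pos Ns with rfl | h
  · simp [empirical, discrete]
  · rw [empirical, discrete, Finset.smul_sum, ENNReal.ofReal_inv_of_pos (by positivity),
      ENNReal.ofReal_natCast]

/-! ### Expectations over the Wasserstein ball -/

section WassersteinBall

variable {ι : Type*} [Fintype ι] {Ns : ℕ}

theorem integral_empirical (ξhat : Fin Ns → ι → ℝ) (f : (ι → ℝ) → ℝ) :
    ∫ x, f x ∂empirical ξhat = 1 / (Ns : ℝ) * ∑ i, f (ξhat i) := by
  rw [empirical_eq_discrete, integral_discrete (fun _ => by positivity), one_div, Finset.mul_sum]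

/-- Moving the atoms `x i` of the empirical distribution to points `y i` of `Ξ` gives a distribution
in the ball if the average displacement is at most `ε`. -/
theorem discrete_mem_wassersteinBall {I : Type*} [Fintype I] (p : Seminorm ℝ (ι → ℝ))
    {Ξ : Set (ι → ℝ)} (ξhat : Fin Ns → ι → ℝ) {ε : ℝ} {ω : I → ℝ} (hω : ∀ i, 0 ≤ ω i)
    (hω1 : ∑ i, ω i = 1) (x y : I → ι → ℝ) (hx : discrete ω x = empirical ξhat)
    (hy : ∀ i, y i ∈ Ξ) (hc : ∑ i, ω i * p (x i - y i) ≤ ε) :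
    discrete ω y ∈ wassersteinBall p Ξ ξhat ε := by
  refine ⟨⟨⟨?_⟩, ae_discrete ω y hy, ?_, 1, one_pos, ?_⟩, ?_⟩
  · rw [← lintegral_one, lintegral_discrete]
    simp only [mul_one]
    rw [← ENNReal.ofReal_sum_of_nonneg fun i _ => hω i, hω1, ENNReal.ofReal_one]
  · rw [lintegral_discrete]
    exact ENNReal.sum_lt_top.2 fun i _ => ENNReal.mul_lt_top ENNReal.ofReal_lt_top
      ENNReal.ofReal_lt_top
  · rw [lintegral_discrete]
    exact ENNReal.sum_lt_top.2 fun i _ => ENNReal.mul_lt_top ENNReal.ofReal_lt_top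
      ENNReal.ofReal_lt_top
  · refine (iInf₂_le (discrete ω fun i => (x i, y i)) ?_).trans ?_
    · exact ⟨(map_discrete _ _ measurable_fst).trans hx, map_discrete _ _ measurable_snd⟩
    · rw [lintegral_discrete]
      simp only [← ENNReal.ofReal_mul (hω _)]
      rw [← ENNReal.ofReal_sum_of_nonneg fun i _ => mul_nonneg (hω i) (apply_nonneg _ _)]
      exact ENNReal.ofReal_le_ofReal hc

/-- The bound on the ball, for the mixture of two distributions that move each sample to one point. -/
theorem mixture_le_of_forall_wassersteinBall (hNs : 0 < Ns) (p : Seminorm ℝ (ι → ℝ))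
    {Ξ : Set (ι → ℝ)} (ξhat : Fin Ns → ι → ℝ) {ε U : ℝ} {f : (ι → ℝ) → ℝ}
    (h : ∀ ν ∈ wassersteinBall p Ξ ξhat ε, ∫ ξ, f ξ ∂ν ≤ U) {y y' : Fin Ns → ι → ℝ}
    (hy : ∀ i, y i ∈ Ξ) (hy' : ∀ i, y' i ∈ Ξ) {θ θ' : ℝ} (hθ : 0 ≤ θ) (hθ' : 0 ≤ θ')
    (hsum : θ + θ' = 1)
    (hc : θ * (1 / (Ns : ℝ) * ∑ i, p (ξhat i - y i)) +
      θ' * (1 / (Ns : ℝ) * ∑ i, p (ξhat i - y' i)) ≤ ε) :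
    θ * (1 / (Ns : ℝ) * ∑ i, f (y i)) + θ' * (1 / (Ns : ℝ) * ∑ i, f (y' i)) ≤ U := by
  have hn : (0 : ℝ) < Ns := by exact_mod_cast hNs
  have hω : ∀ i : Fin Ns ⊕ Fin Ns,
      0 ≤ Sum.elim (fun _ => θ * (Ns : ℝ)⁻¹) (fun _ => θ' * (Ns : ℝ)⁻¹) i := by
    rintro (i | i) <;> simp only [Sum.elim_inl, Sum.elim_inr] <;> positivity
  -- each sample is split into two atoms of masses `θ / Ns` and `θ' / Ns`
  have hmem := discrete_mem_wassersteinBall p (Ξ := Ξ) ξhat (ε := ε) hω ?_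
    (Sum.elim ξhat ξhat) (Sum.elim y y') ?_ ?_ ?_
  · have := h _ hmem
    rw [integral_discrete hω] at this
    simpa [Fintype.sum_sum_type, Finset.mul_sum, mul_assoc] using this
  · have : (Ns : ℝ) * (Ns : ℝ)⁻¹ = 1 := mul_inv_cancel₀ hn.ne'
    simp only [Fintype.sum_sum_type, Sum.elim_inl, Sum.elim_inr, Finset.sum_const,
      Finset.card_univ, Fintype.card_fin, nsmul_eq_mul]
    linear_combination ((Ns : ℝ) * (Ns : ℝ)⁻¹) * hsum + this
  · rw [empirical_eq_discrete, discrete, discrete, Fintype.sum_sum_type]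
    simp only [Sum.elim_inl, Sum.elim_inr]
    rw [← Finset.sum_add_distrib]
    refine Finset.sum_congr rfl fun i _ => ?_
    rw [← add_smul, ← ENNReal.ofReal_add (by positivity) (by positivity), ← add_mul, hsum, one_mul]
  · rintro (i | i)
    exacts [hy i, hy' i]
  · simpa [Fintype.sum_sum_type, Finset.mul_sum, mul_assoc] using hc

/-- A Lagrange multiplier `l` for the transport budget: a supergradient at `ε` of the largest
expectation as a function of the radius. -/
theorem exists_wasserstein_multiplier (hNs : 0 < Ns) (p : Seminorm ℝ (ι → ℝ))
    {Ξ : Set (ι → ℝ)} (ξhat : Fin Ns → ι → ℝ) (hξ : ∀ i, ξhat i ∈ Ξ) {ε U : ℝ} (hε : 0 < ε)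
    {f : (ι → ℝ) → ℝ} (h : ∀ ν ∈ wassersteinBall p Ξ ξhat ε, ∫ ξ, f ξ ∂ν ≤ U) :
    ∃ l : ℝ, 0 ≤ l ∧ ∀ y : Fin Ns → ι → ℝ, (∀ i, y i ∈ Ξ) →
      l * ε + 1 / (Ns : ℝ) * ∑ i, (f (y i) - l * p (ξhat i - y i)) ≤ U := by
  set c : (Fin Ns → ι → ℝ) → ℝ := fun y => 1 / (Ns : ℝ) * ∑ i, p (ξhat i - y i) with hc
  set v : (Fin Ns → ι → ℝ) → ℝ := fun y => 1 / (Ns : ℝ) * ∑ i, f (y i) with hv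
  have hmix {y y' : Fin Ns → ι → ℝ} (hy : ∀ i, y i ∈ Ξ) (hy' : ∀ i, y' i ∈ Ξ) {θ θ' : ℝ}
      (hθ : 0 ≤ θ) (hθ' : 0 ≤ θ') (hsum : θ + θ' = 1) (hcc : θ * c y + θ' * c y' ≤ ε) :
      θ * v y + θ' * v y' ≤ U :=
    mixture_le_of_forall_wassersteinBall hNs p ξhat h hy hy' hθ hθ' hsum hcc
  have hpure {y : Fin Ns → ι → ℝ} (hy : ∀ i, y i ∈ Ξ) (hcy : c y ≤ ε) : v y ≤ U := by
    have := hmix hy hy zero_le_one le_rfl (add_zero 1) (by simpa using hcy)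
    simpa using this
  have hslope {y y' : Fin Ns → ι → ℝ} (hy : ∀ i, y i ∈ Ξ) (hy' : ∀ i, y' i ∈ Ξ) (hcy : ε < c y)
      (hcy' : c y' < ε) : (v y - U) / (c y - ε) ≤ (U - v y') / (ε - c y') := by
    have h1 : 0 < c y - ε := by linarith
    have h2 : 0 < ε - c y' := by linarith
    have h3 : 0 < c y - c y' := by linarith
    -- the mixture whose transport cost is exactly `ε`
    have := hmix hy hy' (θ := (ε - c y') / (c y - c y')) (θ' := (c y - ε) / (c y - c y'))
      (by positivity) (by positivity) (by rw [← add_div]; field_simp; ring)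
      (le_of_eq (by field_simp; ring))
    rw [div_mul_eq_mul_div, div_mul_eq_mul_div, ← add_div, div_le_iff₀ h3] at this
    rw [div_le_div_iff₀ h1 h2]
    linarith
  have hξc : c ξhat = 0 := by simp [hc]
  -- the largest slope from the point `(ε, U)` to the points beyond it
  set A : Set ℝ := insert 0 {s | ∃ y : Fin Ns → ι → ℝ, (∀ i, y i ∈ Ξ) ∧ ε < c y ∧
    s = (v y - U) / (c y - ε)} with hA
  have hbound {y' : Fin Ns → ι → ℝ} (hy' : ∀ i, y' i ∈ Ξ) (hcy' : c y' < ε) :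
      ∀ s ∈ A, s ≤ (U - v y') / (ε - c y') := by
    rintro s (rfl | ⟨y, hy, hcy, rfl⟩)
    · exact div_nonneg (sub_nonneg.2 (hpure hy' hcy'.le)) (by linarith)
    · exact hslope hy hy' hcy hcy'
  have hbdd : BddAbove A := ⟨_, hbound hξ (by rw [hξc]; exact hε)⟩
  refine ⟨sSup A, le_csSup hbdd (Set.mem_insert _ _), fun y hy => ?_⟩
  have hgoal : v y - U ≤ sSup A * (c y - ε) := by
    rcases lt_trichotomy (c y) ε with hlt | heq | hgt
    · have := csSup_le ⟨0, Set.mem_insert _ _⟩ (hbound hy hlt)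
      rw [le_div_iff₀ (by linarith)] at this
      linarith
    · rw [heq, sub_self, mul_zero]
      linarith [hpure hy heq.le]
    · rw [← div_le_iff₀ (by linarith)]
      exact le_csSup hbdd (Set.mem_insert_of_mem _ ⟨y, hy, hgt, rfl⟩)
  rw [Finset.sum_sub_distrib, ← Finset.mul_sum]
  simp only [hc, hv] at hgoal
  linarith

/-- Once the budget is priced by `l`, the maximization splits over the samples: `s i` is the supremum
of `f ξ - l * p (ξ - ξhat i)` over `Ξ`. -/
theorem exists_sample_bounds (hNs : 0 < Ns) (p : Seminorm ℝ (ι → ℝ))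
    {Ξ : Set (ι → ℝ)} (ξhat : Fin Ns → ι → ℝ) (hξ : ∀ i, ξhat i ∈ Ξ) {ε U : ℝ} (hε : 0 < ε)
    {f : (ι → ℝ) → ℝ} (h : ∀ ν ∈ wassersteinBall p Ξ ξhat ε, ∫ ξ, f ξ ∂ν ≤ U) :
    ∃ (l : ℝ) (s : Fin Ns → ℝ), 0 ≤ l ∧ l * ε + 1 / (Ns : ℝ) * ∑ i, s i ≤ U ∧
      ∀ i, ∀ ξ ∈ Ξ, f ξ - l * p (ξ - ξhat i) ≤ s i := by
  obtain ⟨l, hl, hly⟩ := exists_wasserstein_multiplier hNs p ξhat hξ hε h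
  have hn : (0 : ℝ) < Ns := by exact_mod_cast hNs
  set F : Fin Ns → (ι → ℝ) → ℝ := fun i ξ => f ξ - l * p (ξhat i - ξ) with hF
  have hsum (y : Fin Ns → ι → ℝ) (hy : ∀ i, y i ∈ Ξ) : ∑ i, F i (y i) ≤ Ns * (U - l * ε) := by
    have := hly y hy
    rw [← div_le_iff₀' hn, div_eq_inv_mul, ← one_div]
    linarith
  have hbdd (i : Fin Ns) : BddAbove (F i '' Ξ) := by
    refine ⟨Ns * (U - l * ε) - ∑ k ∈ Finset.univ.erase i, F k (ξhat k), ?_⟩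
    rintro _ ⟨ξ, hξΞ, rfl⟩
    have := hsum (Function.update ξhat i ξ) fun k => by
      by_cases hk : k = i
      · subst hk; simpa using hξΞ
      · simpa [hk] using hξ k
    rw [← Finset.add_sum_erase _ _ (Finset.mem_univ i), Function.update_self,
      Finset.sum_congr rfl fun k hk => by
        rw [Function.update_of_ne (Finset.ne_of_mem_erase hk)]] at this
    linarith
  refine ⟨l, fun i => sSup (F i '' Ξ), hl, ?_, fun i ξ hξΞ => ?_⟩
  · refine le_of_forall_pos_le_add fun δ hδ => ?_
    have hex (i : Fin Ns) : ∃ ξ ∈ Ξ, sSup (F i '' Ξ) - δ < F i ξ := by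
      obtain ⟨_, ⟨ξ, hξΞ, rfl⟩, hlt⟩ :=
        exists_lt_of_lt_csSup (Set.Nonempty.image (F i) ⟨_, hξ i⟩) (sub_lt_self _ hδ)
      exact ⟨ξ, hξΞ, hlt⟩
    choose y hy hlt using hex
    have h1 : ∑ i, (sSup (F i '' Ξ) - δ) ≤ Ns * (U - l * ε) :=
      (Finset.sum_le_sum fun i _ => (hlt i).le).trans (hsum y hy)
    rw [Finset.sum_sub_distrib, Finset.sum_const, Finset.card_univ, Fintype.card_fin,
      nsmul_eq_mul] at h1
    have h2 : 1 / (Ns : ℝ) * ∑ i, sSup (F i '' Ξ) ≤ U - l * ε + δ := by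
      rw [one_div, inv_mul_le_iff₀ hn]
      linarith
    linarith
  · rw [map_sub_rev]
    exact le_csSup (hbdd i) ⟨ξ, hξΞ, rfl⟩

/-- Weak duality for the Wasserstein ball. The infimum over the couplings need not be attained, so a
coupling of cost below `ε + δ` is used for every `δ > 0`. -/
theorem integral_le_of_mem_wassersteinBall {p : Seminorm ℝ (ι → ℝ)}
    {Ξ : Set (ι → ℝ)} {ξhat : Fin Ns → ι → ℝ} {ε : ℝ} (hε : 0 < ε)
    {f : (ι → ℝ) → ℝ} {l : ℝ} {s : Fin Ns → ℝ} (hl : 0 ≤ l)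
    (hf : ∀ i, ∀ ξ ∈ Ξ, f ξ ≤ s i + l * p (ξ - ξhat i)) {ν : Measure (ι → ℝ)}
    (hν : ν ∈ wassersteinBall p Ξ ξhat ε) (hint : Integrable f ν) :
    ∫ ξ, f ξ ∂ν ≤ l * ε + 1 / (Ns : ℝ) * ∑ i, s i := by
  obtain ⟨⟨_, hΞ, _⟩, hW⟩ := hν
  -- coinciding samples: the smallest of their bounds is valid
  set F : (ι → ℝ) → ℝ := fun x => ⨅ i : {i // ξhat i = x}, s i with hF
  have hFle (i : Fin Ns) : F (ξhat i) ≤ s i :=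
    ciInf_le (f := fun k : {k // ξhat k = ξhat i} => s k) (Set.finite_range _).bddBelow ⟨i, rfl⟩
  have hfF (i : Fin Ns) (ξ : ι → ℝ) (hξ : ξ ∈ Ξ) : f ξ ≤ F (ξhat i) + l * p (ξhat i - ξ) := by
    have : Nonempty {k // ξhat k = ξhat i} := ⟨⟨i, rfl⟩⟩
    have h1 : f ξ - l * p (ξhat i - ξ) ≤ F (ξhat i) := le_ciInf fun k => by
      have := hf k ξ hξ
      rw [k.2, map_sub_rev] at this
      linarith
    linarith
  have hcost {δ : ℝ} (hδ : 0 < δ) :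
      ∫ ξ, f ξ ∂ν ≤ l * (ε + δ) + 1 / (Ns : ℝ) * ∑ i, s i := by
    have hlt : wasserstein p (empirical ξhat) ν < ENNReal.ofReal (ε + δ) :=
      hW.trans_lt ((ENNReal.ofReal_lt_ofReal_iff (by linarith)).2 (by linarith))
    simp only [wasserstein, iInf_lt_iff] at hlt
    obtain ⟨π, ⟨hπ₁, hπ₂⟩, hπ⟩ := hlt
    have hc0 : Continuous fun z : (ι → ℝ) × (ι → ℝ) => p (z.1 - z.2) :=
      (continuous_seminorm_pi p).comp (continuous_fst.sub continuous_snd)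
    have hcint : Integrable (fun z : (ι → ℝ) × (ι → ℝ) => p (z.1 - z.2)) π := by
      refine ⟨hc0.measurable.aestronglyMeasurable, ?_⟩
      rw [hasFiniteIntegral_iff_ofReal (Filter.Eventually.of_forall fun z => apply_nonneg _ _)]
      exact hπ.trans ENNReal.ofReal_lt_top
    have hcle : ∫ z, p (z.1 - z.2) ∂π ≤ ε + δ := by
      rw [integral_eq_lintegral_of_nonneg_ae (Filter.Eventually.of_forall fun z => apply_nonneg _ _)
        hc0.measurable.aestronglyMeasurable]
      exact ENNReal.toReal_le_of_le_ofReal (by linarith) hπ.le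
    have hFint : Integrable F (π.map Prod.fst) := by
      rw [hπ₁, empirical_eq_discrete]
      exact integrable_discrete _ _ _
    have hfint : Integrable f (π.map Prod.snd) := hπ₂ ▸ hint
    have hae₁ : ∀ᵐ z ∂π, ∃ i, ξhat i = z.1 :=
      ae_of_ae_map measurable_fst.aemeasurable (p := fun x => ∃ i, ξhat i = x) (by
        rw [hπ₁, empirical_eq_discrete]
        exact ae_discrete _ _ fun i => ⟨i, rfl⟩)
    have hae₂ : ∀ᵐ z ∂π, z.2 ∈ Ξ :=
      ae_of_ae_map measurable_snd.aemeasurable (p := fun x => x ∈ Ξ) (by rwa [hπ₂])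
    calc ∫ ξ, f ξ ∂ν = ∫ z, f z.2 ∂π := by
          rw [← hπ₂, integral_map measurable_snd.aemeasurable hfint.1]
      _ ≤ ∫ z, (F z.1 + l * p (z.1 - z.2)) ∂π := by
          refine integral_mono_ae (hfint.comp_measurable measurable_snd)
            ((hFint.comp_measurable measurable_fst).add (hcint.const_mul l)) ?_
          filter_upwards [hae₁, hae₂] with z ⟨i, hi⟩ hz
          have := hfF i z.2 hz
          rwa [hi] at this
      _ = ∫ x, F x ∂empirical ξhat + l * ∫ z, p (z.1 - z.2) ∂π := by
          rw [← hπ₁, integral_map measurable_fst.aemeasurable hFint.1, ← integral_const_mul]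
          exact integral_add (hFint.comp_measurable measurable_fst) (hcint.const_mul l)
      _ ≤ 1 / (Ns : ℝ) * ∑ i, s i + l * (ε + δ) := by
          rw [integral_empirical]
          exact add_le_add (mul_le_mul_of_nonneg_left (Finset.sum_le_sum fun i _ => hFle i)
            (by positivity)) (mul_le_mul_of_nonneg_left hcle hl)
      _ = _ := add_comm _ _
  refine le_of_forall_pos_le_add fun δ hδ => ?_
  have h1 := hcost (δ := δ / (l + 1)) (by positivity)
  have h2 : l * (δ / (l + 1)) ≤ δ := by
    rw [mul_div_assoc', div_le_iff₀ (by positivity)]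
    nlinarith
  linarith

theorem integrable_dotProduct {p : Seminorm ℝ (ι → ℝ)} (hp : ∀ ξ, p ξ = 0 → ξ = 0)
    {Ξ : Set (ι → ℝ)} {ν : Measure (ι → ℝ)} (hν : ν ∈ distributionsOn p Ξ) (a : ι → ℝ) :
    Integrable (fun ξ => a ⬝ᵥ ξ) ν := by
  obtain ⟨_, _, hfin, _⟩ := hν
  obtain ⟨c, hc, hle⟩ := exists_norm_le_mul_seminorm hp
  have hpint : Integrable p ν := by
    refine ⟨(continuous_seminorm_pi p).measurable.aestronglyMeasurable, ?_⟩
    rwa [hasFiniteIntegral_iff_ofReal (Filter.Eventually.of_forall fun z => apply_nonneg _ _)]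
  refine integrable_finsetSum _ fun q _ => Integrable.const_mul ?_ _
  refine (hpint.const_mul c).mono' (measurable_pi_apply q).aestronglyMeasurable
    (Filter.Eventually.of_forall fun ξ => (norm_le_pi_norm ξ q).trans (hle ξ))

theorem integrable_iSup_affine {p : Seminorm ℝ (ι → ℝ)} (hp : ∀ ξ, p ξ = 0 → ξ = 0)
    {Ξ : Set (ι → ℝ)} {ν : Measure (ι → ℝ)} (hν : ν ∈ distributionsOn p Ξ) {T : Type*}
    [Fintype T] (b : T → ℝ) (a : T → ι → ℝ) :
    Integrable (fun ξ => ⨆ t, (b t + a t ⬝ᵥ ξ)) ν := by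
  have := hν.1
  have h (t : T) : Integrable (fun ξ => b t + a t ⬝ᵥ ξ) ν :=
    (integrable_const _).add (integrable_dotProduct hp hν (a t))
  have hmeas (t : T) : Measurable fun ξ : ι → ℝ => b t + a t ⬝ᵥ ξ := by
    simp only [dotProduct]
    fun_prop
  refine (integrable_finsetSum Finset.univ fun t _ => (h t).norm).mono'
    (Measurable.iSup hmeas).aestronglyMeasurable (Filter.Eventually.of_forall fun ξ => ?_)
  rcases isEmpty_or_nonempty T with hT | hT
  · simp
  · obtain ⟨t, ht⟩ := exists_eq_ciSup_of_finite (f := fun t => b t + a t ⬝ᵥ ξ)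
    rw [← ht]
    exact Finset.single_le_sum (f := fun t => ‖b t + a t ⬝ᵥ ξ‖) (fun _ _ => norm_nonneg _)
      (Finset.mem_univ t)

end WassersteinBall

/-! ### Equivalence of the constraints -/

namespace Problem

variable {nx nu ny nw N Ns Nb r : ℕ} (P : Problem nx nu ny nw N Ns Nb r)

theorem loss_le_of_coneFeasible (hN : 0 < N) (hp : ∀ ξ, P.p ξ = 0 → ξ = 0)
    {H : LawMatrix N nu ny} {lam : Fin Nb → ℝ} {s : Fin Ns → Fin Nb → ℝ}
    {γ : Fin Ns → Fin Nb → Fin N → Fin r → ℝ} (hz : (H, lam, s, γ) ∈ P.coneFeasible) (j : Fin Nb)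
    (i : Fin Ns) {ξ : Fin N × Fin nw → ℝ} (hξ : ξ ∈ P.support) :
    loss P.sys P.x₀ H ξ (P.g j) ≤ s i j + lam j * P.p (ξ - P.ξhat i) := by
  obtain ⟨hH, -, h3, h4, h5⟩ := hz
  have : Nonempty (Fin N) := ⟨⟨0, hN⟩⟩
  rw [P.loss_eq hH]
  refine ciSup_le fun t => ?_
  -- split `⟨a, ξ - ξ̂⟩` into `⟨a - Cᵀ γ, ξ - ξ̂⟩` and `⟨γ, C ξ - C ξ̂⟩`
  have e1 : P.aVec H t j ⬝ᵥ ξ = P.aVec H t j ⬝ᵥ P.ξhat i +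
      (P.Cξᵀ *ᵥ γ i j t - P.aVec H t j) ⬝ᵥ (P.ξhat i - ξ) +
      γ i j t ⬝ᵥ (P.Cξ *ᵥ ξ - P.Cξ *ᵥ P.ξhat i) := by
    have (η : Fin N × Fin nw → ℝ) : (P.Cξᵀ *ᵥ γ i j t) ⬝ᵥ η = γ i j t ⬝ᵥ P.Cξ *ᵥ η := by
      rw [Matrix.mulVec_transpose, Matrix.dotProduct_mulVec]
    simp only [sub_dotProduct, dotProduct_sub, this]
    ring
  have e2 : γ i j t ⬝ᵥ (P.Cξ *ᵥ ξ - P.Cξ *ᵥ P.ξhat i) ≤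
      γ i j t ⬝ᵥ (P.dξ - P.Cξ *ᵥ P.ξhat i) :=
    Finset.sum_le_sum fun k _ => mul_le_mul_of_nonneg_left
      (sub_le_sub_right (hξ k) _) (h5 i j t k)
  have e3 := (dotProduct_le_dualNorm_mul hp (P.Cξᵀ *ᵥ γ i j t - P.aVec H t j)
    (P.ξhat i - ξ)).trans (mul_le_mul_of_nonneg_right (h4 i j t) (apply_nonneg _ _))
  rw [map_sub_rev] at e3
  linarith [h3 i j t]

theorem mem_feasible_iff {H : LawMatrix N nu ny} : H ∈ P.feasible ↔ IsCausal H ∧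
    ∀ j, ∀ ν ∈ P.ball, ∫ ξ, loss P.sys P.x₀ H ξ (P.g j) ∂ν ≤ P.U j := by
  simp only [feasible, Set.mem_ofPred_eq, iSup_le_iff, EReal.coe_le_coe_iff]

theorem mem_feasible_of_mem_coneFeasible (hN : 0 < N) (hNs : 0 < Ns)
    (hp : ∀ ξ, P.p ξ = 0 → ξ = 0) (hε : 0 < P.ε) {H : LawMatrix N nu ny} {y : AuxVar N Ns Nb r}
    (hz : (H, y) ∈ P.coneFeasible) : H ∈ P.feasible := by
  obtain ⟨lam, s, γ⟩ := y
  have hH : IsCausal H := hz.1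
  refine P.mem_feasible_iff.2 ⟨hH, fun j ν hν => ?_⟩
  have hl : 0 ≤ lam j := (dualNorm_nonneg hp _).trans (hz.2.2.2.1 ⟨0, hNs⟩ j ⟨0, hN⟩)
  refine (integral_le_of_mem_wassersteinBall hε (s := fun i => s i j) hl
    (fun i ξ hξ => P.loss_le_of_coneFeasible hN hp hz j i hξ) hν ?_).trans (hz.2.1 j)
  simp only [P.loss_eq hH]
  exact integrable_iSup_affine hp hν.1 _ _

/-- Strong duality: `λ` and `s` come from the Wasserstein ball, and `γ` from the polyhedral support
seen from each sample, that is, in the variable `η = ξ - ξ̂_i`. -/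
theorem exists_mem_coneFeasible (hNs : 0 < Ns) (hε : 0 < P.ε)
    (hsamples : ∀ i, P.ξhat i ∈ P.support) {H : LawMatrix N nu ny} (hH : H ∈ P.feasible) :
    ∃ y, (H, y) ∈ P.coneFeasible := by
  obtain ⟨hc, hU⟩ := P.mem_feasible_iff.1 hH
  choose lam s hl hs hbound using fun j =>
    exists_sample_bounds hNs P.p P.ξhat hsamples hε (hU j)
  have hγ (i : Fin Ns) (j : Fin Nb) (t : Fin N) := exists_multiplier P.p P.Cξ
    (e := P.dξ - P.Cξ *ᵥ P.ξhat i) (fun k => sub_nonneg.2 (hsamples i k)) (P.aVec H t j)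
    (l := lam j) (κ := s j i - P.bVal H t j - P.aVec H t j ⬝ᵥ P.ξhat i) (hl j) (fun η hη => by
      have h1 := hbound j i (P.ξhat i + η) fun k => by
        have := hη k
        rw [Pi.sub_apply] at this
        rw [Matrix.mulVec_add, Pi.add_apply]
        linarith
      have h2 : P.bVal H t j + P.aVec H t j ⬝ᵥ (P.ξhat i + η) ≤
          loss P.sys P.x₀ H (P.ξhat i + η) (P.g j) := by
        rw [P.loss_eq hc]
        exact le_ciSup (f := fun t => P.bVal H t j + P.aVec H t j ⬝ᵥ (P.ξhat i + η))
          (Set.finite_range _).bddAbove t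
      rw [add_sub_cancel_left] at h1
      rw [dotProduct_add] at h2
      linarith)
  choose γ hγ0 hγe hγn using hγ
  refine ⟨(lam, fun i j => s j i, γ), hc, hs, fun i j t => ?_, hγn, hγ0⟩
  linarith [hγe i j t]

end Problem

end DRMPC

theorem mainTheorem1 {nx nu ny nw N Ns Nb r : ℕ}
    (P : DRMPC.Problem nx nu ny nw N Ns Nb r)
    (hN : 0 < N) (hNs : 0 < Ns)
    (hβ : 0 < P.β) (hβ1 : P.β ≤ 1)
    (hQ : P.Q.PosSemidef) (hQf : P.Qf.PosSemidef) (hR : P.R.PosDef)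
    (hp : ∀ ξ, P.p ξ = 0 → ξ = 0)
    (hε : 0 < P.ε)
    (hsamples : ∀ i, P.ξhat i ∈ P.support)
    (hiid : P.iidBall.Nonempty) :
    -- the constraints are equivalent
    (∀ H : DRMPC.LawMatrix N nu ny, H ∈ P.feasible ↔ ∃ y, (H, y) ∈ P.coneFeasible) ∧
    -- the objectives agree
    (∀ H : DRMPC.LawMatrix N nu ny, DRMPC.IsCausal H →
      P.objectiveInf H = (P.coneObjective H : EReal) ∧
      P.objectiveSup H = (P.coneObjective H : EReal)) ∧
    -- the optimal values agree
    (⨅ H ∈ P.feasible, P.objectiveInf H) =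
      (⨅ z ∈ P.coneFeasible, (P.coneObjective z.1 : EReal)) ∧
    (⨅ H ∈ P.feasible, P.objectiveSup H) =
      (⨅ z ∈ P.coneFeasible, (P.coneObjective z.1 : EReal)) ∧
    -- the optimal control laws agree
    (∀ H : DRMPC.LawMatrix N nu ny,
      ((H ∈ P.feasible ∧ IsMinOn P.objectiveInf P.feasible H) ↔
        ∃ y, (H, y) ∈ P.coneFeasible ∧
          IsMinOn (fun z => P.coneObjective z.1) P.coneFeasible (H, y)) ∧
      ((H ∈ P.feasible ∧ IsMinOn P.objectiveSup P.feasible H) ↔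
        ∃ y, (H, y) ∈ P.coneFeasible ∧
          IsMinOn (fun z => P.coneObjective z.1) P.coneFeasible (H, y))) ∧
    -- the cone program is convex
    Convex ℝ P.coneFeasible ∧
    ConvexOn ℝ P.coneFeasible (fun z => P.coneObjective z.1) := by
  have hfeas (H : DRMPC.LawMatrix N nu ny) : H ∈ P.feasible ↔ ∃ y, (H, y) ∈ P.coneFeasible :=
    ⟨P.exists_mem_coneFeasible hNs hε hsamples,
      fun ⟨_, hy⟩ => P.mem_feasible_of_mem_coneFeasible hN hNs hp hε hy⟩
  have hInf (H) (hH : H ∈ P.feasible) := P.objectiveInf_eq hiid hH.1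
  have hSup (H) (hH : H ∈ P.feasible) := P.objectiveSup_eq hiid hH.1
  have hval (f : DRMPC.LawMatrix N nu ny → EReal)
      (hf : ∀ H ∈ P.feasible, f H = (P.coneObjective H : EReal)) :
      (⨅ H ∈ P.feasible, f H) = ⨅ z ∈ P.coneFeasible, (P.coneObjective z.1 : EReal) := by
    rw [biInf_congr hf]
    refine le_antisymm (le_iInf₂ fun z hz => ?_) (le_iInf₂ fun H hH => ?_)
    · exact iInf₂_le z.1 ((hfeas z.1).2 ⟨z.2, hz⟩)
    · obtain ⟨y, hy⟩ := (hfeas H).1 hH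
      exact iInf₂_le (H, y) hy
  have hopt (f : DRMPC.LawMatrix N nu ny → EReal)
      (hf : ∀ H ∈ P.feasible, f H = (P.coneObjective H : EReal)) (H : DRMPC.LawMatrix N nu ny) :
      (H ∈ P.feasible ∧ IsMinOn f P.feasible H) ↔ ∃ y, (H, y) ∈ P.coneFeasible ∧
          IsMinOn (fun z => P.coneObjective z.1) P.coneFeasible (H, y) := by
    simp only [isMinOn_iff]
    constructor
    · rintro ⟨hH, hmin⟩
      obtain ⟨y, hy⟩ := (hfeas H).1 hH
      refine ⟨y, hy, fun z hz => ?_⟩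
      have hz' := (hfeas z.1).2 ⟨z.2, hz⟩
      have := hmin z.1 hz'
      rwa [hf H hH, hf z.1 hz', EReal.coe_le_coe_iff] at this
    · rintro ⟨y, hy, hmin⟩
      have hH := (hfeas H).2 ⟨y, hy⟩
      refine ⟨hH, fun H' hH' => ?_⟩
      obtain ⟨y', hy'⟩ := (hfeas H').1 hH'
      rw [hf H hH, hf H' hH', EReal.coe_le_coe_iff]
      exact hmin (H', y') hy'
  exact ⟨hfeas, fun H hH => ⟨P.objectiveInf_eq hiid hH, P.objectiveSup_eq hiid hH⟩,
    hval _ hInf, hval _ hSup, fun H => ⟨hopt _ hInf H, hopt _ hSup H⟩,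
    P.convex_coneFeasible hp, P.convex_coneFeasible hp, fun z _ z' _ _ _ hθ hθ' hsum =>
      P.coneObjective_convexComb_le hβ hQ hQf hR hiid z.1 z'.1 hθ hθ' hsum⟩
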